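/- Fix integers $n,m\ge 1$ and basis functions $b_1,\dots,b_m:\{1,\dots,n\}\to\mathbb R$ that are positive, convex (i.e. $b_j(x+1)-b_j(x)$ is non-decreasing in $x$) and strictly increasing; more generally, convexity and strict increasingness of $b_j$ may be weakened to strict convexity of $x\mapsto b_j(x)x$ on $\{0,1,\dots,n\}$ together with $b_j(n)>b_j(n-1)$. Throughout, functions on $\{1,\dots,n\}$ are extended by $b_j(0)=f(0)=f(n+1)=0$. Consider the class $\mathcal G$ of congestion games with at most $n$ users and finitely many resources, in which user $i$ chooses a set $a_i$ of resources from a nonempty list $\mathcal A_i$, and each resource $e$ has a cost $\ell_e=\sum_{j=1}^m\alpha_jb_j$ with coefficients $\alpha_j\ge 0$. With $|a|_e$ the number of users selecting $e$, the system cost is $\mathrm{SC}(a)=\sum_i\sum_{e\in a_i}\ell_e(|a|_e)$. A local tolling mechanism $T$ assigns to each resource a toll $\tau_e=T(\ell_e):\{1,\dots,n\}\to\mathbb R$ depending only on its cost function, and user $i$ then pays $\sum_{e\in a_i}[\ell_e(|a|_e)+\tau_e(|a|_e)]$. The price of anarchy $\mathrm{PoA}(T)$ is the supremum, over games in $\mathcal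 G$ and equilibria of the tolled game, of the (expected) system cost at equilibrium divided by the minimum system cost (instances with ratio $0/0$ being disregarded). The statements below hold for each of the following equilibrium notions: pure Nash, mixed Nash, correlated and coarse correlated equilibria. (i) For each $j$, the linear program $$\rho^\star_j=\max_{f\in\mathbb R^n,\ \rho\in\mathbb R}\ \rho$$ subject to $$b_j(v)v-\rho\, b_j(u)u+f(u)u-f(u+1)v\ \ge 0\qquad \forall u,v\in\{0,\dots,n\},\ u+v\le n,$$ $$b_j(v)v-\rho\, b_j(u)u+f(u)(n-v)-f(u+1)(n-u)\ \ge 0\qquad \forall u,v\in\{0,\dots,n\},\ u+v> n,$$ has a solution, and $\rho^\star_j>0$. If $(f^\star_j,\rho^\star_j)$ are solutions, then the mechanism $$T^\star\Big(\sum_{j=1}^m\alpha_jb_j\Big)=\sum_{j=1}^m\alpha_j\tau^\star_j,\qquad \tau^\star_j(x)=f^\star_j(x)-b_j(x),$$ minimizes the price of anarchy over all local tolling mechanisms, and the optimal price of anarchy is $\mathrm{PoA}(T^\star)=\max_j 1/\rho^\star_j$. (If a resource cost has several representations $\sum_j\alpha_jb_j$, any of them may be used to define its toll.) (ii) For each $j$,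 a solution $(f_j^\star,\rho_j^\star)$ of this program is given explicitly by $f^\star_j(1)=b_j(1)$ and, for $u\in\{1,\dots,n-1\}$, $$f^\star_j(u+1)=\min_{v\in\{1,\dots,n\}}\ \beta(u,v)f^\star_j(u)+\gamma(u,v)-\delta(u,v)\rho^\star_j,$$ $$\beta(u,v)=\frac{\min\{u,n-v\}}{\min\{v,n-u\}},\quad \gamma(u,v)=\frac{b_j(v)v}{\min\{v,n-u\}},\quad \delta(u,v)=\frac{b_j(u)u}{\min\{v,n-u\}},$$ where $$\rho^\star_j=\min_{(v_1,\dots,v_n)\in\{1,\dots,n\}^{n-1}\times\{0,\dots,n\}}\ \frac{(n-v_n)\Big(\prod_{u=1}^{n-1}\beta_u\, b_j(1)+\sum_{u=1}^{n-1}\big(\prod_{i=u+1}^{n-1}\beta_i\big)\gamma_u\Big)+b_j(v_n)v_n}{(n-v_n)\sum_{u=1}^{n-1}\big(\prod_{i=u+1}^{n-1}\beta_i\big)\delta_u+b_j(n)n},$$ with $\beta_u=\beta(u,v_u)$, $\gamma_u=\gamma(u,v_u)$, $\delta_u=\delta(u,v_u)$, and empty products equal to $1$, empty sums equal to $0$.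 -/

import Mathlib

/-! ### Functions of the congestion level -/

/-- Real functions on the set `{1, …, n}` of positive congestion levels: resource costs,
basis functions and tolls. -/
abbrev CostFn (n : ℕ) := Set.Icc 1 n → ℝ

/-- The value at `x`, with the convention that it is `0` outside `{1, …, n}`
(in particular `f 0 = f (n + 1) = 0`). -/
noncomputable def CostFn.at {n : ℕ} (f : CostFn n) (x : ℕ) : ℝ :=
  if h : x ∈ Set.Icc 1 n then f ⟨x, h⟩ else 0

/-- Convexity in the discrete sense on `{1, …, n}`: `b (x + 1) - b x` is non-decreasing. -/
def CostFn.Convex {n : ℕ} (b : CostFn n) : Prop :=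
  ∀ x : ℕ, 1 ≤ x → x + 2 ≤ n → b.at (x + 1) - b.at x ≤ b.at (x + 2) - b.at (x + 1)

/-- Strict convexity in the discrete sense of `x ↦ b x * x` on `{0, 1, …, n}`. -/
def CostFn.StrictConvexMul {n : ℕ} (b : CostFn n) : Prop :=
  ∀ x : ℕ, x + 2 ≤ n →
    b.at (x + 1) * (x + 1 : ℕ) - b.at x * (x : ℕ) <
      b.at (x + 2) * (x + 2 : ℕ) - b.at (x + 1) * (x + 1 : ℕ)

/-- The assumption on a basis function: it is positive and either convex and strictly
increasing, or, more generally, such that `b x * x` is strictly convex and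
`b n > b (n - 1)`. -/
def CostFn.IsAdmissible {n : ℕ} (b : CostFn n) : Prop :=
  (∀ x, 0 < b x) ∧
    ((b.Convex ∧ StrictMono b) ∨ (b.StrictConvexMul ∧ b.at (n - 1) < b.at n))

/-- The resource costs `∑ j, α j • b j` with `α j ≥ 0`. -/
def costClass {n m : ℕ} (b : Fin m → CostFn n) : Set (CostFn n) :=
  {ℓ | ∃ α : Fin m → ℝ, (∀ j, 0 ≤ α j) ∧ ℓ = ∑ j, α j • b j}

/-! ### Congestion games, tolls and equilibria -/

/-- A congestion game with (at most) `n` users. -/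
structure CongestionGame (n : ℕ) where
  /-- the number of users -/
  N : ℕ
  N_le : N ≤ n
  /-- the resources -/
  E : Type
  [fintypeE : Fintype E]
  [decE : DecidableEq E]
  /-- the cost function of each resource -/
  ℓ : E → CostFn n
  /-- the feasible choices of each user -/
  A : Fin N → Finset (Finset E)
  A_nonempty : ∀ i, (A i).Nonempty

attribute [instance] CongestionGame.fintypeE CongestionGame.decE

/-- A local tolling mechanism: the toll of a resource is a function of the cost function of
that resource only. -/
abbrev LocalMechanism (n : ℕ) := CostFn n → CostFn n

namespace CongestionGame

variable {n : ℕ} (G : CongestionGame n)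

/-- Allocations: a feasible choice for each user. -/
abbrev Alloc := ∀ i : Fin G.N, {s : Finset G.E // s ∈ G.A i}

/-- The number of users selecting the resource `e`. -/
def load (a : G.Alloc) (e : G.E) : ℕ :=
  (Finset.univ.filter fun i => e ∈ (a i).1).card

/-- The system cost. -/
noncomputable def systemCost (a : G.Alloc) : ℝ :=
  ∑ i, ∑ e ∈ (a i).1, (G.ℓ e).at (G.load a e)

/-- The cost of user `i`, which includes the tolls. -/
noncomputable def userCost (T : LocalMechanism n) (i : Fin G.N) (a : G.Alloc) : ℝ :=
  ∑ e ∈ (a i).1, ((G.ℓ e).at (G.load a e) + (T (G.ℓ e)).at (G.load a e))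

/-- The minimum system cost. -/
noncomputable def minCost : ℝ := ⨅ a : G.Alloc, G.systemCost a

/-- Expectation with respect to a distribution over allocations. -/
noncomputable def expect (σ : G.Alloc → ℝ) (X : G.Alloc → ℝ) : ℝ := ∑ a, σ a * X a

/-- Pure Nash equilibria. -/
def IsPureNash (T : LocalMechanism n) (a : G.Alloc) : Prop :=
  ∀ (i : Fin G.N) (s : {s : Finset G.E // s ∈ G.A i}),
    G.userCost T i a ≤ G.userCost T i (Function.update a i s)

/-- Coarse correlated equilibria. -/
def IsCoarseCorrelated (T : LocalMechanism n) (σ : G.Alloc → ℝ) : Prop :=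
  σ ∈ stdSimplex ℝ G.Alloc ∧
    ∀ (i : Fin G.N) (s : {s : Finset G.E // s ∈ G.A i}),
      G.expect σ (G.userCost T i) ≤
        G.expect σ (fun a => G.userCost T i (Function.update a i s))

/-- Correlated equilibria. -/
def IsCorrelated (T : LocalMechanism n) (σ : G.Alloc → ℝ) : Prop :=
  σ ∈ stdSimplex ℝ G.Alloc ∧
    ∀ (i : Fin G.N)
      (φ : {s : Finset G.E // s ∈ G.A i} → {s : Finset G.E // s ∈ G.A i}),
      G.expect σ (G.userCost T i) ≤
        G.expect σ (fun a => G.userCost T i (Function.update a i (φ (a i))))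

/-- Mixed Nash equilibria, identified with the product distributions that they induce. -/
def IsMixedNash (T : LocalMechanism n) (σ : G.Alloc → ℝ) : Prop :=
  ∃ p : ∀ i : Fin G.N, {s : Finset G.E // s ∈ G.A i} → ℝ,
    (∀ i, p i ∈ stdSimplex ℝ {s : Finset G.E // s ∈ G.A i}) ∧
      (∀ a, σ a = ∏ i, p i (a i)) ∧
      ∀ (i : Fin G.N) (s : {s : Finset G.E // s ∈ G.A i}),
        G.expect σ (G.userCost T i) ≤
          G.expect σ (fun a => G.userCost T i (Function.update a i s))

end CongestionGame

/-- The equilibrium notions. -/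
inductive EqConcept
  | pureNash
  | mixedNash
  | correlated
  | coarseCorrelated

/-- The distribution `σ` over allocations is an equilibrium of the given kind; a pure Nash
equilibrium is viewed as a point mass. -/
def CongestionGame.IsEquilibrium {n : ℕ} (G : CongestionGame n) (T : LocalMechanism n)
    (σ : G.Alloc → ℝ) : EqConcept → Prop
  | .pureNash => ∃ a, G.IsPureNash T a ∧ σ = Pi.single a 1
  | .mixedNash => G.IsMixedNash T σ
  | .correlated => G.IsCorrelated T σ
  | .coarseCorrelated => G.IsCoarseCorrelated T σ

/-- The price of anarchy of `T` over all games with at most `n` users and resource costs in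
`L`: the supremum, over games and equilibria, of the ratio between the (expected) system cost
at equilibrium and the minimum system cost. In `ℝ≥0∞` the ratio is `⊤` if only the minimum
cost is zero, and an instance with ratio `0 / 0` does not contribute. -/
noncomputable def PoA {n : ℕ} (κ : EqConcept) (L : Set (CostFn n)) (T : LocalMechanism n) :
    ENNReal :=
  ⨆ (G : CongestionGame n) (_ : ∀ e, G.ℓ e ∈ L)
    (σ : G.Alloc → ℝ) (_ : G.IsEquilibrium T σ κ),
    ENNReal.ofReal (G.expect σ G.systemCost) / ENNReal.ofReal G.minCost

/-- The mechanism `T` satisfies `T (∑ j, α j • b j) = ∑ j, α j • τ j` with `τ j = f j - b j`.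
If the `b j` are linearly dependent, a resource cost may have several representations
`∑ j, α j • b j`; then any of them may be used to define its toll. -/
def IsInducedMechanism {n m : ℕ} (b f : Fin m → CostFn n) (T : LocalMechanism n) : Prop :=
  ∀ ℓ ∈ costClass b, ∃ α : Fin m → ℝ, (∀ j, 0 ≤ α j) ∧ ℓ = ∑ j, α j • b j ∧
    T ℓ = ∑ j, α j • (f j - b j)

/-! ### The simplified linear program -/

/-- Feasibility of `(f, ρ)` for the simplified linear program of the basis function `b`. -/
def SimplifiedLPFeasible {n : ℕ} (b f : CostFn n) (ρ : ℝ) : Prop :=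
  ∀ u v : ℕ, u ≤ n → v ≤ n →
    (u + v ≤ n →
      0 ≤ b.at v * v - ρ * b.at u * u + f.at u * u - f.at (u + 1) * v) ∧
    (n < u + v →
      0 ≤ b.at v * v - ρ * b.at u * u + f.at u * ((n : ℝ) - v)
        - f.at (u + 1) * ((n : ℝ) - u))

/-- `(f, ρ)` solves the simplified linear program, which maximizes `ρ`. -/
def IsSimplifiedLPSolution {n : ℕ} (b f : CostFn n) (ρ : ℝ) : Prop :=
  SimplifiedLPFeasible b f ρ ∧
    ∀ (f' : CostFn n) (ρ' : ℝ), SimplifiedLPFeasible b f' ρ' → ρ' ≤ ρ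

/-! ### The explicit solution -/

/-- `β(u,v) = min{u, n - v} / min{v, n - u}` -/
noncomputable def betaCoef (n u v : ℕ) : ℝ := (min u (n - v) : ℕ) / (min v (n - u) : ℕ)

/-- `γ(u,v) = b(v) v / min{v, n - u}` -/
noncomputable def gammaCoef {n : ℕ} (b : CostFn n) (u v : ℕ) : ℝ :=
  b.at v * v / (min v (n - u) : ℕ)

/-- `δ(u,v) = b(u) u / min{v, n - u}` -/
noncomputable def deltaCoef {n : ℕ} (b : CostFn n) (u v : ℕ) : ℝ :=
  b.at u * u / (min v (n - u) : ℕ)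

/-- The recursion: `f 1 = b 1`, and for `1 ≤ u ≤ n - 1` the value `f (u + 1)` is the minimum
over `v ∈ {1, …, n}` of `β(u,v) f(u) + γ(u,v) - δ(u,v) ρ`. -/
def SatisfiesRecursion {n : ℕ} (b : CostFn n) (ρ : ℝ) (f : CostFn n) : Prop :=
  f.at 1 = b.at 1 ∧
    ∀ u : ℕ, 1 ≤ u → u < n →
      IsLeast
        ((fun v : ℕ => betaCoef n u v * f.at u + gammaCoef b u v - deltaCoef b u v * ρ) ''
          Set.Icc 1 n)
        (f.at (u + 1))

/-- The quotient attached to a tuple `(v 1, …, v n)`. The summand `u = n - 1` carries an empty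
product, so it is `γ_{n-1}` in the numerator and `δ_{n-1}` in the denominator. -/
noncomputable def tupleRatio {n : ℕ} (b : CostFn n) (v : ℕ → ℕ) : ℝ :=
  (((n : ℝ) - v n) *
      ((∏ u ∈ Finset.Icc 1 (n - 1), betaCoef n u (v u)) * b.at 1 +
        ∑ u ∈ Finset.Icc 1 (n - 1),
          (∏ i ∈ Finset.Icc (u + 1) (n - 1), betaCoef n i (v i)) * gammaCoef b u (v u)) +
    b.at (v n) * (v n : ℕ)) /
  (((n : ℝ) - v n) *
      (∑ u ∈ Finset.Icc 1 (n - 1),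
        (∏ i ∈ Finset.Icc (u + 1) (n - 1), betaCoef n i (v i)) * deltaCoef b u (v u)) +
    b.at n * n)

/-- The tuples in `{1, …, n}^(n-1) × {0, …, n}`; only the entries `v 1, …, v n` matter. -/
def tuples (n : ℕ) : Set (ℕ → ℕ) :=
  {v | (∀ u ∈ Set.Icc 1 (n - 1), v u ∈ Set.Icc 1 n) ∧ v n ∈ Set.Icc 0 n}

/-! A resource matters only through its load `u` at equilibrium, its load `v` at the optimum and the
number `x` of users who select it in both. If `F` is its tolled cost, then the users' costs minus
their costs after unilateral switches to the optimum add up to `F u * (u - x) - F (u + 1) * (v - x)`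
summed over resources, and in expectation this is at most `0` at any equilibrium. If `b v * v - ρ *
b u * u` plus that expression is nonnegative for every realizable triple, the price of anarchy is at
most `1 / ρ`.

Upper bound: the program only imposes the smallest overlap `x = max 0 (u + v - n)`. The expression
is affine in `x`, with slope `F (u + 1) - F u`. Where this is nonnegative the smallest overlap is
the worst case. Otherwise `x = min u v` is, and the required inequalities propagate from
neighbouring loads by convexity of `b x * x` (`SimplifiedLPFeasible.overlap`). Combining the `b j`
linearly gives `IsInducedMechanism.PoA_le`.

Lower bound: in cyclic games on `ℤ/n` all resources of a block have the same `u`, `v` and the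
smallest overlap, and all users are in symmetric positions. Mixing blocks in natural proportions
turns a bound `R` on the price of anarchy of any mechanism into the hypothesis of a one-dimensional
Farkas lemma; its multiplier scales the tolled cost to a feasible point with `ρ = 1 / R`
(`exists_feasible_of_PoA_le`).

Explicit solution: for fixed `ρ` the constraints with `u < n` and `v ≥ 1` bound `f (u + 1)` by
increasing functions of `f u`, so the recursion gives the largest candidate. Unrolled along a tuple,
the constraint at `u = n` says exactly that `ρ` is at most the tuple ratio. The constraints with `v
= 0`, absent from the recursion, are recovered in `SatisfiesRecursion.lower_slope`. -/

/-! ### The total cost `x ↦ b x * x` -/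

/-- The total cost `b x * x` at congestion level `x`. -/
noncomputable def CostFn.total {n : ℕ} (b : CostFn n) (x : ℕ) : ℝ := b.at x * x

namespace CostFn

variable {n : ℕ}

lemma at_of_mem (f : CostFn n) {x : ℕ} (h : x ∈ Set.Icc 1 n) : f.at x = f ⟨x, h⟩ :=
  dif_pos h

lemma at_zero (f : CostFn n) : f.at 0 = 0 := dif_neg (by simp)

lemma at_of_lt (f : CostFn n) {x : ℕ} (h : n < x) : f.at x = 0 :=
  dif_neg (by simp [h])

lemma at_add (f g : CostFn n) (x : ℕ) : (f + g).at x = f.at x + g.at x := by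
  unfold CostFn.at; split <;> simp

lemma at_smul (c : ℝ) (f : CostFn n) (x : ℕ) : (c • f).at x = c * f.at x := by
  unfold CostFn.at; split <;> simp

lemma at_sum {ι : Type*} (s : Finset ι) (f : ι → CostFn n) (x : ℕ) :
    (∑ j ∈ s, f j).at x = ∑ j ∈ s, (f j).at x := by
  unfold CostFn.at; split <;> simp

lemma at_pos {b : CostFn n} (hb : ∀ x, 0 < b x) {x : ℕ} (h1 : 1 ≤ x) (h2 : x ≤ n) :
    0 < b.at x := by
  rw [at_of_mem b ⟨h1, h2⟩]; exact hb _

lemma at_nonneg {b : CostFn n} (hb : ∀ x, 0 < b x) (x : ℕ) : 0 ≤ b.at x := by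
  unfold CostFn.at
  split
  · exact (hb _).le
  · exact le_rfl

lemma total_zero (b : CostFn n) : b.total 0 = 0 := by simp [total]

lemma total_pos {b : CostFn n} (hb : ∀ x, 0 < b x) {x : ℕ} (h1 : 1 ≤ x) (h2 : x ≤ n) :
    0 < b.total x :=
  mul_pos (at_pos hb h1 h2) (by exact_mod_cast h1)

lemma total_nonneg {b : CostFn n} (hb : ∀ x, 0 < b x) (x : ℕ) : 0 ≤ b.total x :=
  mul_nonneg (at_nonneg hb x) (by positivity)

end CostFn

/-- Discrete convexity of a real sequence on `{0, …, n}`. -/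
def DiscreteConvex (n : ℕ) (g : ℕ → ℝ) : Prop :=
  ∀ x : ℕ, x + 2 ≤ n → g (x + 1) - g x ≤ g (x + 2) - g (x + 1)

lemma CostFn.IsAdmissible.discreteConvex_total {n : ℕ} {b : CostFn n} (hb : b.IsAdmissible) :
    DiscreteConvex n b.total := by
  intro x hx
  obtain ⟨hpos, ⟨hc, hm⟩ | ⟨hc, -⟩⟩ := hb
  · have hlt : ∀ y : ℕ, 1 ≤ y → y + 1 ≤ n → b.at y < b.at (y + 1) := by
      intro y h1 h2
      rw [b.at_of_mem ⟨h1, by omega⟩, b.at_of_mem ⟨by omega, h2⟩]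
      exact hm (Subtype.mk_lt_mk.2 (Nat.lt_succ_self y))
    have h2 := hlt (x + 1) (by omega) (by omega)
    rcases Nat.eq_zero_or_pos x with rfl | hx0
    · simp only [CostFn.total]
      norm_num at h2 ⊢
      linarith
    · have h1 := hlt x hx0 (by omega)
      have h3 := hc x hx0 hx
      simp only [CostFn.total]
      push_cast
      have : (0 : ℝ) ≤ x := by positivity
      nlinarith
  · have := hc x hx
    simp only [CostFn.total]
    linarith

namespace DiscreteConvex

variable {n : ℕ} {g : ℕ → ℝ}

lemma increment_mono (hg : DiscreteConvex n g) {x y : ℕ} (hxy : x ≤ y) (hy : y + 1 ≤ n) :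
    g (x + 1) - g x ≤ g (y + 1) - g y := by
  induction y, hxy using Nat.le_induction with
  | base => exact le_rfl
  | succ y hxy ih => exact (ih (by omega)).trans (hg y hy)

lemma sub_le_mul_increment (hg : DiscreteConvex n g) {u v : ℕ} (hv : v ≤ u) (hu : u + 1 ≤ n) :
    g u - g v ≤ ((u : ℝ) - v) * (g (u + 1) - g u) := by
  have key : ∀ k, v + k ≤ u → g (v + k) - g v ≤ k * (g (u + 1) - g u) := by
    intro k
    induction k with
    | zero => intro; simp
    | succ k ih =>
      intro hk
      have h1 := ih (by omega)
      have h2 := hg.increment_mono (x := v + k) (y := u) (by omega) hu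
      push_cast
      rw [← Nat.add_assoc]
      linarith
  have := key (u - v) (by omega)
  rwa [Nat.add_sub_cancel' hv, Nat.cast_sub hv] at this

lemma mul_increment_le_sub (hg : DiscreteConvex n g) {u v : ℕ} (hv : u + 1 ≤ v) (hvn : v ≤ n) :
    ((v : ℝ) - (u + 1 : ℕ)) * (g (u + 1) - g u) ≤ g v - g (u + 1) := by
  have key : ∀ k, u + 1 + k ≤ n → k * (g (u + 1) - g u) ≤ g (u + 1 + k) - g (u + 1) := by
    intro k
    induction k with
    | zero => intro; simp
    | succ k ih =>
      intro hk
      have h1 := ih (by omega)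
      have h2 := hg.increment_mono (x := u) (y := u + 1 + k) (by omega) (by omega)
      push_cast
      rw [← Nat.add_assoc]
      linarith
  have := key (v - (u + 1)) (by omega)
  rwa [Nat.add_sub_cancel' hv, Nat.cast_sub hv] at this

/-- If a line of slope `c` through `(u + 1, ρ g (u + 1))` lies below `g` on `{0, …, u}`, then so
does its translate through `(u, ρ g u)` on `{0, …, u - 1}`. -/
lemma lower_slope_of_succ (hg : DiscreteConvex n g) (hg0 : ∀ x, 0 ≤ g x) {ρ c : ℝ} (h0 : 0 ≤ ρ)
    (h1 : ρ ≤ 1) {u : ℕ} (hu : u + 1 ≤ n)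
    (hc : ∀ v < u + 1, ρ * g (u + 1) - g v ≤ c * ((u + 1 : ℕ) - v)) :
    ∀ v < u, ρ * g u - g v ≤ c * (u - v) := by
  intro v hv
  have hvu : (0 : ℝ) ≤ (u : ℝ) - v := sub_nonneg.2 (by exact_mod_cast hv.le)
  rcases le_total c (ρ * (g (u + 1) - g u)) with h | h
  · have := hc v (by omega)
    push_cast at this
    linarith
  · have h2 := mul_le_mul_of_nonneg_left (hg.sub_le_mul_increment hv.le hu) h0
    have h3 := mul_le_mul_of_nonneg_right h hvu
    have h4 := mul_le_mul_of_nonneg_right h1 (hg0 v)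
    nlinarith

/-- If a line of slope `c` through `(u, ρ g u)` lies below `g` on `{u + 1, …, n}`, then so does
its translate through `(u + 1, ρ g (u + 1))` on `{u + 2, …, n}`. -/
lemma upper_slope_succ (hg : DiscreteConvex n g) (hg0 : ∀ x, 0 ≤ g x) {ρ c : ℝ} (h0 : 0 ≤ ρ)
    (h1 : ρ ≤ 1) {u : ℕ} (hc : ∀ v, u < v → v ≤ n → c * (v - u) ≤ g v - ρ * g u) :
    ∀ v, u + 1 < v → v ≤ n → c * (v - (u + 1 : ℕ)) ≤ g v - ρ * g (u + 1) := by
  intro v hv hvn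
  have hvu : (0 : ℝ) ≤ (v : ℝ) - (u + 1 : ℕ) := sub_nonneg.2 (by exact_mod_cast hv.le)
  rcases le_total (ρ * (g (u + 1) - g u)) c with h | h
  · have := hc v (by omega) hvn
    push_cast
    linarith
  · have h2 := mul_le_mul_of_nonneg_left (hg.mul_increment_le_sub hv.le hvn) h0
    have h3 := mul_le_mul_of_nonneg_right h hvu
    have h4 := mul_le_mul_of_nonneg_right h1 (hg0 v)
    nlinarith

end DiscreteConvex

/-! ### From minimal overlaps to arbitrary overlaps -/

/-- Truncated subtraction makes `u + v - n` the smallest overlap in both ranges, which merges the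
two families of constraints. -/
lemma simplifiedLPFeasible_iff {n : ℕ} {b f : CostFn n} {ρ : ℝ} :
    SimplifiedLPFeasible b f ρ ↔ ∀ u v : ℕ, u ≤ n → v ≤ n →
      0 ≤ b.total v - ρ * b.total u + f.at u * ((u : ℝ) - (u + v - n : ℕ)) -
        f.at (u + 1) * ((v : ℝ) - (u + v - n : ℕ)) := by
  have key : ∀ u v : ℕ, (u + v ≤ n → ((u + v - n : ℕ) : ℝ) = 0) ∧
      (n < u + v → ((u + v - n : ℕ) : ℝ) = u + v - n) := by
    intro u v
    refine ⟨fun h => by simp [Nat.sub_eq_zero_of_le h], fun h => ?_⟩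
    rw [Nat.cast_sub h.le]; push_cast; rfl
  constructor
  · intro h u v hu hv
    rcases le_or_gt (u + v) n with huv | huv
    · have := (h u v hu hv).1 huv
      rw [(key u v).1 huv]
      simp only [CostFn.total]
      linarith
    · have := (h u v hu hv).2 huv
      rw [(key u v).2 huv]
      simp only [CostFn.total]
      linarith
  · intro h u v hu hv
    have := h u v hu hv
    simp only [CostFn.total] at this
    refine ⟨fun huv => ?_, fun huv => ?_⟩
    · rw [(key u v).1 huv] at this
      linarith
    · rw [(key u v).2 huv] at this
      linarith

lemma SimplifiedLPFeasible.le_one {n : ℕ} (hn : 1 ≤ n) {b f : CostFn n} {ρ : ℝ}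
    (hb : ∀ x, 0 < b x) (h : SimplifiedLPFeasible b f ρ) : ρ ≤ 1 := by
  have := simplifiedLPFeasible_iff.1 h n n le_rfl le_rfl
  rw [Nat.add_sub_cancel] at this
  have hp := CostFn.total_pos hb hn le_rfl
  by_contra! hρ
  nlinarith

/-- One step of the downward induction bounding `f` from below. -/
lemma lower_slope_step {n : ℕ} {g f : ℕ → ℝ} (hg : DiscreteConvex n g) (hg0 : ∀ x, 0 ≤ g x)
    {ρ : ℝ} (h0 : 0 ≤ ρ) (h1 : ρ ≤ 1) {u v : ℕ} (hu : u + 1 ≤ n) (hv : v < u)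
    (hf : 0 ≤ g v - ρ * g u + f u * ((u : ℝ) - (u + v - n : ℕ)) -
      f (u + 1) * ((v : ℝ) - (u + v - n : ℕ)))
    (hs : ∀ v < u + 1, ρ * g (u + 1) - g v ≤ f (u + 1) * ((u + 1 : ℕ) - v)) :
    ρ * g u - g v ≤ f u * (u - v) := by
  rcases le_total (f u) (f (u + 1)) with h | h
  · have hm : (0 : ℝ) ≤ (v : ℝ) - (u + v - n : ℕ) :=
      sub_nonneg.2 (by exact_mod_cast (by omega : u + v - n ≤ v))
    nlinarith
  · have hm : (0 : ℝ) ≤ (u : ℝ) - v := sub_nonneg.2 (by exact_mod_cast hv.le)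
    have := hg.lower_slope_of_succ hg0 h0 h1 hu hs v hv
    nlinarith

namespace SimplifiedLPFeasible

variable {n : ℕ} {b f : CostFn n} {ρ : ℝ}

/-- The constraint for the full overlap `x = v < u`. Downward induction works because at `u = n` the
smallest overlap already equals `v`. -/
lemma lower_slope (hn : 1 ≤ n) (hb : b.IsAdmissible) (h : SimplifiedLPFeasible b f ρ)
    (h0 : 0 ≤ ρ) {u : ℕ} (hu : u ≤ n) :
    ∀ v < u, ρ * b.total u - b.total v ≤ f.at u * (u - v) := by
  induction hu using Nat.decreasingInduction with
  | self =>
    intro v hv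
    have := simplifiedLPFeasible_iff.1 h n v le_rfl hv.le
    rw [Nat.add_sub_cancel_left] at this
    linarith
  | of_succ u hu ih =>
    intro v hv
    exact lower_slope_step hb.discreteConvex_total (CostFn.total_nonneg hb.1) h0
      (h.le_one hn hb.1) hu hv (simplifiedLPFeasible_iff.1 h u v hu.le (hv.trans hu).le) ih

/-- The constraint for the full overlap `x = u < v`. The induction goes upward, since at `u = 0` the
only overlap is `0`. If `f` does not decrease at the current step the given constraint suffices;
otherwise convexity carries the earlier bound over. -/
lemma upper_slope (hn : 1 ≤ n) (hb : b.IsAdmissible) (h : SimplifiedLPFeasible b f ρ)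
    (h0 : 0 ≤ ρ) {u : ℕ} (hu : u ≤ n) :
    ∀ v, u < v → v ≤ n → f.at (u + 1) * (v - u) ≤ b.total v - ρ * b.total u := by
  induction u with
  | zero =>
    intro v _ hvn
    have := simplifiedLPFeasible_iff.1 h 0 v (by omega) hvn
    rw [Nat.sub_eq_zero_of_le (by omega)] at this
    simp only [f.at_zero, Nat.cast_zero] at this
    push_cast
    linarith
  | succ u ih =>
    intro v hv hvn
    rcases le_total (f.at (u + 1)) (f.at (u + 1 + 1)) with hle | hle
    · have := simplifiedLPFeasible_iff.1 h (u + 1) v hu hvn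
      have hm : (0 : ℝ) ≤ ((u + 1 : ℕ) : ℝ) - (u + 1 + v - n : ℕ) :=
        sub_nonneg.2 (by exact_mod_cast (by omega : u + 1 + v - n ≤ u + 1))
      nlinarith
    · have hm : (0 : ℝ) ≤ (v : ℝ) - (u + 1 : ℕ) := sub_nonneg.2 (by exact_mod_cast hv.le)
      have := hb.discreteConvex_total.upper_slope_succ (CostFn.total_nonneg hb.1) h0
        (h.le_one hn hb.1) (ih (by omega)) v hv hvn
      nlinarith

/-- The constraints of the simplified program, which are those for the smallest possible overlap
`u + v - n` of two sets of `u` and `v` users, hold for all overlaps `x`. -/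
theorem overlap (hn : 1 ≤ n) (hb : b.IsAdmissible) (h : SimplifiedLPFeasible b f ρ)
    (h0 : 0 ≤ ρ) {u v x : ℕ} (hxu : x ≤ u) (hxv : x ≤ v) (hu : u ≤ n) (hv : v ≤ n)
    (hx : u + v ≤ n + x) :
    0 ≤ b.total v - ρ * b.total u + f.at u * ((u : ℝ) - x) - f.at (u + 1) * ((v : ℝ) - x) := by
  rcases le_total (f.at u) (f.at (u + 1)) with hle | hle
  · have := simplifiedLPFeasible_iff.1 h u v hu hv
    have hm : (0 : ℝ) ≤ (x : ℝ) - (u + v - n : ℕ) :=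
      sub_nonneg.2 (by exact_mod_cast (by omega : u + v - n ≤ x))
    nlinarith
  · rcases lt_trichotomy u v with huv | rfl | huv
    · have := h.upper_slope hn hb h0 hu v huv hv
      have hm : (0 : ℝ) ≤ (u : ℝ) - x := sub_nonneg.2 (by exact_mod_cast hxu)
      nlinarith
    · have hm : (0 : ℝ) ≤ (u : ℝ) - x := sub_nonneg.2 (by exact_mod_cast hxu)
      have := mul_le_mul_of_nonneg_right (h.le_one hn hb.1) (CostFn.total_nonneg hb.1 u)
      nlinarith
    · have := h.lower_slope hn hb h0 hu v huv
      have hm : (0 : ℝ) ≤ (v : ℝ) - x := sub_nonneg.2 (by exact_mod_cast hxv)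
      nlinarith

end SimplifiedLPFeasible

/-! ### The recursion and its unrolled form -/

lemma Set.Finite.isLeast_csInf {s : Set ℝ} (hs : s.Finite) (hne : s.Nonempty) :
    IsLeast s (sInf s) :=
  ⟨hne.csInf_mem hs, fun _ hx => csInf_le hs.bddBelow hx⟩

/-- The values `f 1, f 2, …` determined by the recursion. -/
noncomputable def recursionSeq {n : ℕ} (b : CostFn n) (ρ : ℝ) : ℕ → ℝ
  | 0 => b.at 1
  | k + 1 => sInf ((fun v : ℕ => betaCoef n (k + 1) v * recursionSeq b ρ k +
      gammaCoef b (k + 1) v - deltaCoef b (k + 1) v * ρ) '' Set.Icc 1 n)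

lemma exists_satisfiesRecursion {n : ℕ} (hn : 1 ≤ n) (b : CostFn n) (ρ : ℝ) :
    ∃ f, SatisfiesRecursion b ρ f := by
  have key : ∀ u, 1 ≤ u → u ≤ n →
      -- `recursionSeq` is indexed from `0`, so its entry `u - 1` is the value at level `u`.
      CostFn.at (fun x : Set.Icc 1 n => recursionSeq b ρ (x - 1)) u =
        recursionSeq b ρ (u - 1) := fun u h1 h2 => CostFn.at_of_mem _ ⟨h1, h2⟩
  refine ⟨fun x => recursionSeq b ρ (x - 1), ?_, fun u h1 h2 => ?_⟩
  · rw [key 1 le_rfl hn]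
    rfl
  · rw [key u h1 h2.le, key (u + 1) (by omega) h2]
    obtain ⟨k, rfl⟩ : ∃ k, u = k + 1 := ⟨u - 1, by omega⟩
    exact ((Set.finite_Icc 1 n).image _).isLeast_csInf ⟨_, 1, ⟨le_rfl, hn⟩, rfl⟩

lemma betaCoef_nonneg (n u v : ℕ) : 0 ≤ betaCoef n u v := by unfold betaCoef; positivity

lemma gammaCoef_pos {n : ℕ} {b : CostFn n} (hb : ∀ x, 0 < b x) {u v : ℕ} (hu : u < n)
    (hv : v ∈ Set.Icc 1 n) : 0 < gammaCoef b u v := by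
  have : 0 < min v (n - u) := lt_min hv.1 (by omega)
  exact div_pos (CostFn.total_pos hb hv.1 hv.2) (by exact_mod_cast this)

lemma gammaCoef_nonneg {n : ℕ} {b : CostFn n} (hb : ∀ x, 0 < b x) (u v : ℕ) :
    0 ≤ gammaCoef b u v := div_nonneg (CostFn.total_nonneg hb v) (by positivity)

lemma deltaCoef_nonneg {n : ℕ} {b : CostFn n} (hb : ∀ x, 0 < b x) (u v : ℕ) :
    0 ≤ deltaCoef b u v := div_nonneg (CostFn.total_nonneg hb u) (by positivity)

/-- The number of users outside the minimal overlap is positive. -/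
lemma sub_overlap_pos {n u v : ℕ} (hu : u < n) (hv : 1 ≤ v) :
    (0 : ℝ) < (v : ℝ) - (u + v - n : ℕ) :=
  sub_pos.2 (by exact_mod_cast (by omega : u + v - n < v))

lemma recursion_term_eq {n : ℕ} (b : CostFn n) (ρ a : ℝ) {u v : ℕ} (hu : u < n)
    (hvn : v ≤ n) :
    betaCoef n u v * a + gammaCoef b u v - deltaCoef b u v * ρ =
      (b.total v - ρ * b.total u + a * ((u : ℝ) - (u + v - n : ℕ))) /
        ((v : ℝ) - (u + v - n : ℕ)) := by
  have h1 : ((min v (n - u) : ℕ) : ℝ) = (v : ℝ) - (u + v - n : ℕ) := by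
    rw [← Nat.cast_sub (by omega)]; congr 1; omega
  have h2 : ((min u (n - v) : ℕ) : ℝ) = (u : ℝ) - (u + v - n : ℕ) := by
    rw [← Nat.cast_sub (by omega)]; congr 1; omega
  unfold betaCoef gammaCoef deltaCoef CostFn.total
  rw [h1, h2]
  ring

lemma le_recursion_term_iff {n : ℕ} (b : CostFn n) (ρ a c : ℝ) {u v : ℕ} (hu : u < n)
    (hv : v ∈ Set.Icc 1 n) :
    c ≤ betaCoef n u v * a + gammaCoef b u v - deltaCoef b u v * ρ ↔
      0 ≤ b.total v - ρ * b.total u + a * ((u : ℝ) - (u + v - n : ℕ)) -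
        c * ((v : ℝ) - (u + v - n : ℕ)) := by
  rw [recursion_term_eq b ρ a hu hv.2, le_div_iff₀ (sub_overlap_pos hu hv.1), sub_nonneg]

/-- The solution at `K` of the linear recursion `s (k + 1) = β (k + 1) * s k + c (k + 1)` with
`s 0 = 0`. -/
noncomputable def weightedSum (β c : ℕ → ℝ) (K : ℕ) : ℝ :=
  ∑ u ∈ Finset.Icc 1 K, (∏ i ∈ Finset.Icc (u + 1) K, β i) * c u

lemma weightedSum_succ (β c : ℕ → ℝ) (K : ℕ) :
    weightedSum β c (K + 1) = β (K + 1) * weightedSum β c K + c (K + 1) := by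
  unfold weightedSum
  rw [Finset.sum_Icc_succ_top (by omega), Finset.Icc_eq_empty (a := K + 1 + 1) (by omega),
    Finset.prod_empty, one_mul, Finset.mul_sum]
  congr 1
  refine Finset.sum_congr rfl fun u hu => ?_
  rw [Finset.prod_Icc_succ_top (by have := (Finset.mem_Icc.1 hu).2; omega)]
  ring

lemma weightedSum_nonneg {β c : ℕ → ℝ} (hβ : ∀ i, 0 ≤ β i) (hc : ∀ i, 0 ≤ c i) (K : ℕ) :
    0 ≤ weightedSum β c K :=
  Finset.sum_nonneg fun _ _ => mul_nonneg (Finset.prod_nonneg fun _ _ => hβ _) (hc _)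

/-- The upper bound for `f (K + 1)` obtained by choosing the term `v u` in step `u` of the
recursion. -/
noncomputable def unrolled {n : ℕ} (b : CostFn n) (ρ : ℝ) (v : ℕ → ℕ) (K : ℕ) : ℝ :=
  (∏ u ∈ Finset.Icc 1 K, betaCoef n u (v u)) * b.at 1 +
    weightedSum (fun u => betaCoef n u (v u)) (fun u => gammaCoef b u (v u)) K -
    weightedSum (fun u => betaCoef n u (v u)) (fun u => deltaCoef b u (v u)) K * ρ

lemma unrolled_zero {n : ℕ} (b : CostFn n) (ρ : ℝ) (v : ℕ → ℕ) : unrolled b ρ v 0 = b.at 1 := by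
  simp [unrolled, weightedSum]

lemma unrolled_succ {n : ℕ} (b : CostFn n) (ρ : ℝ) (v : ℕ → ℕ) (K : ℕ) :
    unrolled b ρ v (K + 1) = betaCoef n (K + 1) (v (K + 1)) * unrolled b ρ v K +
      gammaCoef b (K + 1) (v (K + 1)) - deltaCoef b (K + 1) (v (K + 1)) * ρ := by
  unfold unrolled
  rw [weightedSum_succ, weightedSum_succ, Finset.prod_Icc_succ_top (by omega)]
  ring

/-! ### The smallest tuple ratio -/

section TupleRatio

variable {n : ℕ} {b : CostFn n}

lemma tupleRatio_denom_pos (hn : 1 ≤ n) (hb : ∀ x, 0 < b x) {v : ℕ → ℕ} (hv : v n ≤ n) :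
    0 < ((n : ℝ) - v n) * weightedSum (fun u => betaCoef n u (v u))
      (fun u => deltaCoef b u (v u)) (n - 1) + b.total n :=
  add_pos_of_nonneg_of_pos
    (mul_nonneg (sub_nonneg.2 (by exact_mod_cast hv))
      (weightedSum_nonneg (fun _ => betaCoef_nonneg _ _ _) (fun _ => deltaCoef_nonneg hb _ _) _))
    (CostFn.total_pos hb hn le_rfl)

/-- A number is at most the ratio of a tuple if and only if the last constraint holds for the
unrolled recursion. -/
lemma le_tupleRatio_iff (hn : 1 ≤ n) (hb : ∀ x, 0 < b x) {v : ℕ → ℕ} (hv : v n ≤ n) (ρ : ℝ) :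
    ρ ≤ tupleRatio b v ↔
      0 ≤ ((n : ℝ) - v n) * unrolled b ρ v (n - 1) + b.total (v n) - ρ * b.total n := by
  change ρ ≤ (((n : ℝ) - v n) * ((∏ u ∈ Finset.Icc 1 (n - 1), betaCoef n u (v u)) * b.at 1 +
    weightedSum (fun u => betaCoef n u (v u)) (fun u => gammaCoef b u (v u)) (n - 1)) +
    b.total (v n)) / (((n : ℝ) - v n) * weightedSum (fun u => betaCoef n u (v u))
      (fun u => deltaCoef b u (v u)) (n - 1) + b.total n) ↔ _
  rw [le_div_iff₀ (tupleRatio_denom_pos hn hb hv), ← sub_nonneg]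
  unfold unrolled
  ring_nf

lemma tupleRatio_congr {v w : ℕ → ℕ} (hn : 1 ≤ n) (h : ∀ u ∈ Finset.Icc 1 n, v u = w u) :
    tupleRatio b v = tupleRatio b w := by
  have h1 : v n = w n := h n (by simp [hn])
  have h2 : ∀ (c : ℕ → ℕ → ℝ) (k : ℕ), ∏ u ∈ Finset.Icc (k + 1) (n - 1), c u (v u) =
      ∏ u ∈ Finset.Icc (k + 1) (n - 1), c u (w u) := fun c k =>
    Finset.prod_congr rfl fun u hu => by
      rw [h u (by simp only [Finset.mem_Icc] at hu ⊢; omega)]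
  have h3 : ∀ c : ℕ → ℕ → ℝ,
      ∑ u ∈ Finset.Icc 1 (n - 1), (∏ i ∈ Finset.Icc (u + 1) (n - 1), betaCoef n i (v i)) *
        c u (v u) =
      ∑ u ∈ Finset.Icc 1 (n - 1), (∏ i ∈ Finset.Icc (u + 1) (n - 1), betaCoef n i (w i)) *
        c u (w u) := fun c =>
    Finset.sum_congr rfl fun u hu => by
      rw [h2, h u (by simp only [Finset.mem_Icc] at hu ⊢; omega)]
  unfold tupleRatio
  rw [h1, h3 (gammaCoef b), h3 (deltaCoef b), h2 (betaCoef n) 0]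

lemma exists_isLeast_tupleRatio (hn : 1 ≤ n) (b : CostFn n) :
    ∃ ρ, IsLeast (tupleRatio b '' tuples n) ρ := by
  have hfin : (tupleRatio b '' tuples n).Finite := by
    -- Tuples are functions on all of `ℕ`, but only the entries at `1, …, n` count, so finitely many
    -- ratios occur.
    refine (Set.finite_range fun w : Fin (n + 1) → Fin (n + 1) =>
      tupleRatio b fun u => if h : u < n + 1 then w ⟨u, h⟩ else 0).subset ?_
    rintro _ ⟨v, ⟨hv, hvn⟩, rfl⟩
    have hle : ∀ u ∈ Finset.Icc 1 n, v u ≤ n := by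
      intro u hu
      rcases (Finset.mem_Icc.1 hu).2.eq_or_lt with rfl | hlt
      · exact hvn.2
      · exact (hv u ⟨(Finset.mem_Icc.1 hu).1, by omega⟩).2
    refine ⟨fun u => Fin.ofNat (n + 1) (v u), tupleRatio_congr hn fun u hu => ?_⟩
    rw [dif_pos (Nat.lt_succ_of_le (Finset.mem_Icc.1 hu).2)]
    exact Nat.mod_eq_of_lt (Nat.lt_succ_of_le (hle u hu))
  exact ⟨_, hfin.isLeast_csInf
    ⟨_, fun _ => n, ⟨fun u _ => ⟨hn, le_rfl⟩, ⟨Nat.zero_le _, le_rfl⟩⟩, rfl⟩⟩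

/-- The coefficients `β` may vanish. If `v n = 0`, positivity comes from the last `γ`, whose product
is empty, or from `b 1` when `n = 1`; otherwise from the total cost at `v n`. -/
lemma tupleRatio_pos (hn : 1 ≤ n) (hb : ∀ x, 0 < b x) {v : ℕ → ℕ} (hv : v ∈ tuples n) :
    0 < tupleRatio b v := by
  have hβ : ∀ u, 0 ≤ betaCoef n u (v u) := fun u => betaCoef_nonneg _ _ _
  refine div_pos ?_ (tupleRatio_denom_pos hn hb hv.2.2)
  have hP : 0 ≤ ∏ u ∈ Finset.Icc 1 (n - 1), betaCoef n u (v u) :=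
    Finset.prod_nonneg fun u _ => hβ u
  have hb1 := CostFn.at_pos hb le_rfl hn
  rcases Nat.eq_zero_or_pos (v n) with h0 | hpos
  · rw [h0]
    have hn0 : (0 : ℝ) < n := by exact_mod_cast hn
    refine add_pos_of_pos_of_nonneg (mul_pos (by simpa using hn0) ?_) (by simp)
    change 0 < _ + weightedSum (fun u => betaCoef n u (v u)) (fun u => gammaCoef b u (v u)) (n - 1)
    obtain ⟨k, rfl⟩ : ∃ k, n = k + 1 := ⟨n - 1, by omega⟩
    rcases Nat.eq_zero_or_pos k with rfl | hk
    · simpa [weightedSum] using hb1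
    · obtain ⟨l, rfl⟩ : ∃ l, k = l + 1 := ⟨k - 1, by omega⟩
      rw [Nat.add_sub_cancel, weightedSum_succ]
      have h1 := gammaCoef_pos hb (Nat.lt_succ_self _) (hv.1 (l + 1) (by simp))
      have h2 := mul_nonneg (hβ (l + 1)) (weightedSum_nonneg hβ
        (fun u => gammaCoef_nonneg hb u (v u)) l)
      have h3 := mul_nonneg hP hb1.le
      rw [Nat.add_sub_cancel] at h3
      linarith
  · refine add_pos_of_nonneg_of_pos (mul_nonneg (sub_nonneg.2 (by exact_mod_cast hv.2.2))
      (add_nonneg (mul_nonneg hP hb1.le) ?_)) (CostFn.total_pos hb hpos hv.2.2)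
    exact weightedSum_nonneg hβ (fun u => gammaCoef_nonneg hb u (v u)) _

end TupleRatio

/-! ### Optimality of the explicit solution -/

/-- A feasible value of the program is at most the ratio of every tuple. -/
lemma SimplifiedLPFeasible.le_tupleRatio {n : ℕ} (hn : 1 ≤ n) {b f : CostFn n} {ρ : ℝ}
    (hb : ∀ x, 0 < b x) (h : SimplifiedLPFeasible b f ρ) {v : ℕ → ℕ} (hv : v ∈ tuples n) :
    ρ ≤ tupleRatio b v := by
  rw [simplifiedLPFeasible_iff] at h
  have key : ∀ K, K + 1 ≤ n → f.at (K + 1) ≤ unrolled b ρ v K := by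
    intro K
    induction K with
    | zero =>
      intro _
      have := h 0 1 (by omega) hn
      rw [Nat.sub_eq_zero_of_le (by omega)] at this
      rw [unrolled_zero]
      simp [CostFn.total, CostFn.at_zero] at this
      simpa using this
    | succ K ih =>
      intro hK
      have hvK := hv.1 (K + 1) ⟨by omega, by omega⟩
      rw [unrolled_succ]
      refine ((le_recursion_term_iff b ρ _ _ (by omega) hvK).2
        (h (K + 1) (v (K + 1)) (by omega) hvK.2)).trans ?_
      have := mul_le_mul_of_nonneg_left (ih (by omega)) (betaCoef_nonneg n (K + 1) (v (K + 1)))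
      linarith
  rw [le_tupleRatio_iff hn hb hv.2.2]
  have h1 := key (n - 1) (by omega)
  rw [Nat.sub_add_cancel hn] at h1
  have h2 := h n (v n) le_rfl hv.2.2
  rw [Nat.add_sub_cancel_left] at h2
  have h3 : (0 : ℝ) ≤ (n : ℝ) - v n := sub_nonneg.2 (by exact_mod_cast hv.2.2)
  nlinarith

/-- Along a tuple of minimizing indices the unrolled bound is an equality. Appending `w` as the last
entry turns the bound by the tuple ratio into this constraint. -/
lemma SatisfiesRecursion.last_constraint {n : ℕ} (hn : 1 ≤ n) {b f : CostFn n} {ρ : ℝ}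
    (hb : ∀ x, 0 < b x) (h : SatisfiesRecursion b ρ f)
    (hρ : ρ ∈ lowerBounds (tupleRatio b '' tuples n)) {w : ℕ} (hw : w ≤ n) :
    0 ≤ b.total w - ρ * b.total n + f.at n * ((n : ℝ) - w) := by
  have hex : ∀ u, ∃ v, 1 ≤ u → u < n → v ∈ Set.Icc 1 n ∧
      betaCoef n u v * f.at u + gammaCoef b u v - deltaCoef b u v * ρ = f.at (u + 1) := by
    intro u
    by_cases hu : 1 ≤ u ∧ u < n
    · obtain ⟨v, hv, hv'⟩ := (h.2 u hu.1 hu.2).1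
      exact ⟨v, fun _ _ => ⟨hv, hv'⟩⟩
    · exact ⟨0, fun h1 h2 => absurd ⟨h1, h2⟩ hu⟩
  choose v hv using hex
  let t : ℕ → ℕ := Function.update v n w
  have ht : ∀ u, u < n → t u = v u := fun u hu => Function.update_of_ne hu.ne _ _
  have htn : t n = w := Function.update_self _ _ _
  have htm : t ∈ tuples n := by
    refine ⟨fun u hu => ?_, ?_⟩
    · have : u < n := by have := hu.2; omega
      rw [ht u this]
      exact (hv u hu.1 this).1
    · rw [htn]
      exact ⟨Nat.zero_le _, hw⟩
  have key : ∀ K, K + 1 ≤ n → unrolled b ρ t K = f.at (K + 1) := by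
    intro K
    induction K with
    | zero => intro _; rw [unrolled_zero]; exact h.1.symm
    | succ K ih =>
      intro hK
      rw [unrolled_succ, ih (by omega), ht _ hK]
      exact (hv (K + 1) (by omega) hK).2
  have h1 := (le_tupleRatio_iff hn hb htm.2.2 ρ).1 (hρ ⟨t, htm, rfl⟩)
  rw [htn, key (n - 1) (by omega), Nat.sub_add_cancel hn] at h1
  linarith

/-! ### Feasibility of the recursive solution. -/

lemma CostFn.IsAdmissible.at_mono {n : ℕ} {b : CostFn n} (hb : b.IsAdmissible) {u v : ℕ}
    (hu : 1 ≤ u) (huv : u ≤ v) (hv : v ≤ n) : b.at u ≤ b.at v := by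
  induction v, huv using Nat.le_induction with
  | base => exact le_rfl
  | succ v huv ih =>
    refine (ih (by omega)).trans ?_
    -- By convexity the chord slopes of `b x * x` from the origin, which are the values of `b`, do
    -- not decrease.
    have h1 := hb.discreteConvex_total.sub_le_mul_increment (Nat.zero_le v) hv
    simp only [CostFn.total, Nat.cast_zero, mul_zero, sub_zero] at h1
    have hv0 : (0 : ℝ) < v := by exact_mod_cast hu.trans huv
    have h2 : (v * (v + 1 : ℕ) : ℝ) * b.at v ≤ (v * (v + 1 : ℕ)) * b.at (v + 1) := by
      push_cast at h1 ⊢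
      linarith
    exact le_of_mul_le_mul_left h2 (by positivity)

lemma DiscreteConvex.lower_slope_of_le {n : ℕ} {g : ℕ → ℝ} (hg : DiscreteConvex n g)
    (hg0 : ∀ x, 0 ≤ g x) {ρ c : ℝ} (h0 : 0 ≤ ρ) (h1 : ρ ≤ 1) {u w : ℕ} (huw : u ≤ w)
    (hw : w ≤ n) (hc : ∀ v < w, ρ * g w - g v ≤ c * (w - v)) :
    ∀ v < u, ρ * g u - g v ≤ c * (u - v) := by
  induction w, huw using Nat.le_induction with
  | base => exact hc
  | succ w _ ih => exact ih (by omega) (hg.lower_slope_of_succ hg0 h0 h1 hw hc)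

namespace SatisfiesRecursion

variable {n : ℕ} {b f : CostFn n} {ρ : ℝ}

lemma constraint (h : SatisfiesRecursion b ρ f) {u v : ℕ} (hu1 : 1 ≤ u) (hu : u < n)
    (hv : v ∈ Set.Icc 1 n) :
    0 ≤ b.total v - ρ * b.total u + f.at u * ((u : ℝ) - (u + v - n : ℕ)) -
      f.at (u + 1) * ((v : ℝ) - (u + v - n : ℕ)) :=
  (le_recursion_term_iff b ρ _ _ hu hv).1 ((h.2 u hu1 hu).2 ⟨v, hv, rfl⟩)

/-- `f` stays above `b 1` as long as it satisfies the lower slope condition. -/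
lemma le_at_succ (hb : b.IsAdmissible) (h : SatisfiesRecursion b ρ f) (h1 : ρ ≤ 1) {u : ℕ}
    (hu1 : 1 ≤ u) (hu : u < n) (hfu : b.at 1 ≤ f.at u)
    (hs : ∀ v < u, ρ * b.total u - b.total v ≤ f.at u * (u - v)) :
    b.at 1 ≤ f.at (u + 1) := by
  obtain ⟨v, hv, hv'⟩ := (h.2 u hu1 hu).1
  have hvn := hv.2
  have hpos := sub_overlap_pos hu hv.1
  have hbv := hb.at_mono le_rfl hv.1 hv.2
  have hv0 : (0 : ℝ) ≤ v := by positivity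
  have hu0 : (0 : ℝ) < u := by exact_mod_cast hu1
  have hs0 := hs 0 hu1
  simp only [CostFn.total_zero, Nat.cast_zero, sub_zero] at hs0
  simp only at hv'
  rw [← hv', recursion_term_eq b ρ _ hu hv.2, le_div_iff₀ hpos]
  rcases le_or_gt (u + v) n with huv | huv
  · rw [Nat.sub_eq_zero_of_le huv]
    simp only [Nat.cast_zero, sub_zero]
    have := mul_le_mul_of_nonneg_right hbv hv0
    unfold CostFn.total at *
    linarith
  · have hm : (0 : ℝ) ≤ (u : ℝ) - (u + v - n : ℕ) :=
      sub_nonneg.2 (by exact_mod_cast (by omega : u + v - n ≤ u))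
    rcases le_or_gt u v with hle | hlt
    · have hm0 : (0 : ℝ) ≤ ((u + v - n : ℕ) : ℝ) := by positivity
      have hbuv := hb.at_mono hu1 hle hv.2
      have hfρ : ρ * b.at u ≤ f.at u := by
        unfold CostFn.total at hs0
        exact le_of_mul_le_mul_right (by linarith) hu0
      have e1 := mul_le_mul_of_nonneg_right hfρ hm
      have e2 := mul_le_mul_of_nonneg_right
        ((mul_le_of_le_one_left (CostFn.at_nonneg hb.1 u) h1).trans hbuv) hm0
      have e3 := mul_le_mul_of_nonneg_right hbv hpos.le
      unfold CostFn.total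
      linarith
    · have e1 := hs v hlt
      have e2 := mul_le_mul_of_nonneg_right hfu hpos.le
      linarith

/-- For the recursion, the constraints with `v = 0` are implied by the others. -/
lemma lower_slope (hb : b.IsAdmissible) (h : SatisfiesRecursion b ρ f) (h0 : 0 ≤ ρ) (h1 : ρ ≤ 1)
    (hlast : ∀ w ≤ n, 0 ≤ b.total w - ρ * b.total n + f.at n * ((n : ℝ) - w)) {u : ℕ}
    (hu1 : 1 ≤ u) (hu : u ≤ n) : ∀ v < u, ρ * b.total u - b.total v ≤ f.at u * (u - v) := by
  have hg := hb.discreteConvex_total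
  have hg0 := CostFn.total_nonneg hb.1
  induction u using Nat.strong_induction_on with
  | _ u ih =>
    have hfu : ∀ k, 1 ≤ k → k ≤ u → b.at 1 ≤ f.at k := by
      intro k hk1
      induction k, hk1 using Nat.le_induction with
      | base => intro; exact h.1.ge
      | succ k hk1 ihk =>
        intro hk
        exact h.le_at_succ hb h1 hk1 (by omega) (ihk (by omega)) (ih k hk hk1 (by omega))
    by_contra hbad
    -- If the condition failed at `u`, a downward induction from `n` would still establish it at
    -- every `w ≥ u`, hence at `u` itself.
    suffices key : ∀ w ≤ n, u ≤ w → ∀ v < w, ρ * b.total w - b.total v ≤ f.at w * (w - v) from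
      hbad (key u hu le_rfl)
    intro w hw
    induction hw using Nat.decreasingInduction with
    | self =>
      intro _ v hv
      have := hlast v hv.le
      linarith
    | of_succ w hw ihw =>
      intro huw v hv
      have hs := ihw (by omega)
      have hfw : b.at 1 ≤ f.at (w + 1) := by
        -- A value `f (w + 1)` below `b 1 ≤ f u` would be a valid slope at `u` by convexity, and
        -- then so would the larger `f u`.
        by_contra! hlt
        refine hbad fun v hv => ?_
        have e1 := hg.lower_slope_of_le hg0 h0 h1 (by omega) hw hs v hv
        have e2 : (0 : ℝ) ≤ (u : ℝ) - v := sub_nonneg.2 (by exact_mod_cast hv.le)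
        have e3 := mul_le_mul_of_nonneg_right (hlt.le.trans (hfu u hu1 le_rfl)) e2
        linarith
      rcases Nat.eq_zero_or_pos v with rfl | hv0
      · have := h.constraint (u := w) (v := 1) (by omega) hw ⟨le_rfl, by omega⟩
        rw [Nat.sub_eq_zero_of_le (by omega)] at this
        simp only [CostFn.total_zero, Nat.cast_zero, sub_zero, Nat.cast_one, mul_one] at this ⊢
        have e : b.total 1 = b.at 1 := by simp [CostFn.total]
        linarith
      · exact lower_slope_step hg hg0 h0 h1 hw hv
          (h.constraint (by omega) hw ⟨hv0, by omega⟩) hs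

theorem feasible (hn : 1 ≤ n) (hb : b.IsAdmissible) (h : SatisfiesRecursion b ρ f)
    (hρ : IsLeast (tupleRatio b '' tuples n) ρ) : SimplifiedLPFeasible b f ρ := by
  have h0 : 0 ≤ ρ := by
    obtain ⟨v, hv, rfl⟩ := hρ.1
    exact (tupleRatio_pos hn hb.1 hv).le
  have htn : (fun _ => n) ∈ tuples n := ⟨fun u _ => ⟨hn, le_rfl⟩, ⟨Nat.zero_le _, le_rfl⟩⟩
  have h1 : ρ ≤ 1 := by
    have := (le_tupleRatio_iff hn hb.1 (v := fun _ => n) le_rfl ρ).1 (hρ.2 ⟨_, htn, rfl⟩)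
    have hp := CostFn.total_pos hb.1 hn le_rfl
    by_contra! hlt
    nlinarith
  have hlast := fun w (hw : w ≤ n) => h.last_constraint hn hb.1 hρ.2 hw
  rw [simplifiedLPFeasible_iff]
  intro u v hu hv
  rcases Nat.eq_zero_or_pos u with rfl | hu0
  · rw [Nat.sub_eq_zero_of_le (by omega)]
    simp only [CostFn.total_zero, CostFn.at_zero, zero_add, h.1, Nat.cast_zero, sub_zero]
    rcases Nat.eq_zero_or_pos v with rfl | hv0
    · simp [CostFn.total_zero]
    · have := mul_le_mul_of_nonneg_right (hb.at_mono le_rfl hv0 hv) (Nat.cast_nonneg (α := ℝ) v)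
      unfold CostFn.total
      linarith
  · rcases hu.eq_or_lt with rfl | hlt
    · rw [Nat.add_sub_cancel_left, f.at_of_lt (Nat.lt_succ_self _)]
      have := hlast v hv
      linarith
    · rcases Nat.eq_zero_or_pos v with rfl | hv0
      · have := h.lower_slope hb h0 h1 hlast hu0 hu 0 hu0
        rw [Nat.sub_eq_zero_of_le (by omega)]
        simp only [Nat.cast_zero, sub_zero] at this ⊢
        linarith
      · exact h.constraint hu0 hlt ⟨hv0, hv⟩

end SatisfiesRecursion

theorem exists_explicit_solution {n : ℕ} (hn : 1 ≤ n) {b : CostFn n} (hb : b.IsAdmissible) :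
    ∃ (ρ : ℝ) (f : CostFn n), IsLeast (tupleRatio b '' tuples n) ρ ∧
      SatisfiesRecursion b ρ f ∧ IsSimplifiedLPSolution b f ρ := by
  obtain ⟨ρ, hρ⟩ := exists_isLeast_tupleRatio hn b
  obtain ⟨f, hf⟩ := exists_satisfiesRecursion hn b ρ
  refine ⟨ρ, f, hρ, hf, hf.feasible hn hb hρ, fun f' ρ' h' => ?_⟩
  obtain ⟨v, hv, rfl⟩ := hρ.1
  exact h'.le_tupleRatio hn hb.1 hv

lemma IsSimplifiedLPSolution.pos {n : ℕ} (hn : 1 ≤ n) {b f : CostFn n} {ρ : ℝ}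
    (hb : b.IsAdmissible) (h : IsSimplifiedLPSolution b f ρ) : 0 < ρ := by
  obtain ⟨ρ', f', ⟨⟨v, hv, rfl⟩, -⟩, -, h'⟩ := exists_explicit_solution hn hb
  exact (tupleRatio_pos hn hb.1 hv).trans_le (h.2 _ _ h'.1)

/-! ### Smoothness of the tolled game -/

namespace CongestionGame

variable {n : ℕ} (G : CongestionGame n)

instance : Nonempty G.Alloc :=
  ⟨fun i => ⟨(G.A_nonempty i).choose, (G.A_nonempty i).choose_spec⟩⟩

/-- What a user of the resource `e` pays for it at congestion level `x`. -/
noncomputable def tolledCost (T : LocalMechanism n) (e : G.E) (x : ℕ) : ℝ :=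
  (G.ℓ e).at x + (T (G.ℓ e)).at x

/-- The number of users that select `e` in both allocations. -/
def overlap (a a' : G.Alloc) (e : G.E) : ℕ :=
  (Finset.univ.filter fun i => e ∈ (a i).1 ∧ e ∈ (a' i).1).card

lemma overlap_le_left (a a' : G.Alloc) (e : G.E) : G.overlap a a' e ≤ G.load a e :=
  Finset.card_le_card fun i hi => by
    simp only [Finset.mem_filter] at hi ⊢; exact ⟨hi.1, hi.2.1⟩

lemma overlap_le_right (a a' : G.Alloc) (e : G.E) : G.overlap a a' e ≤ G.load a' e :=
  Finset.card_le_card fun i hi => by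
    simp only [Finset.mem_filter] at hi ⊢; exact ⟨hi.1, hi.2.2⟩

lemma load_le (a : G.Alloc) (e : G.E) : G.load a e ≤ n :=
  (Finset.card_le_univ _).trans (by simpa using G.N_le)

lemma load_add_load_le (a a' : G.Alloc) (e : G.E) :
    G.load a e + G.load a' e ≤ n + G.overlap a a' e := by
  unfold load overlap
  rw [← Finset.card_union_add_card_inter, ← Finset.filter_and]
  exact Nat.add_le_add_right ((Finset.card_le_univ _).trans (by simpa using G.N_le)) _

lemma load_update (a : G.Alloc) (i : Fin G.N) (s : {s : Finset G.E // s ∈ G.A i}) {e : G.E}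
    (he : e ∈ s.1) :
    G.load (Function.update a i s) e =
      if e ∈ (a i).1 then G.load a e else G.load a e + 1 := by
  have h : (Finset.univ.filter fun k => e ∈ (Function.update a i s k).1) =
      insert i (Finset.univ.filter fun k => e ∈ (a k).1) := by
    ext k
    rcases eq_or_ne k i with rfl | hk
    · simp [he]
    · simp [hk]
  unfold load
  rw [h]
  split_ifs with hi
  · rw [Finset.insert_eq_of_mem (by simpa using hi)]
  · rw [Finset.card_insert_of_notMem (by simpa using hi)]

lemma sum_sum_alloc (a : G.Alloc) (h : Fin G.N → G.E → ℝ) :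
    ∑ i, ∑ e ∈ (a i).1, h i e = ∑ e, ∑ i with e ∈ (a i).1, h i e :=
  Finset.sum_comm' (by simp)

lemma systemCost_eq (a : G.Alloc) : G.systemCost a = ∑ e, (G.ℓ e).total (G.load a e) := by
  unfold systemCost
  rw [G.sum_sum_alloc a fun _ e => (G.ℓ e).at (G.load a e)]
  refine Finset.sum_congr rfl fun e _ => ?_
  rw [Finset.sum_const, nsmul_eq_mul, mul_comm]
  rfl

lemma sum_userCost (T : LocalMechanism n) (a : G.Alloc) :
    ∑ i, G.userCost T i a = ∑ e, G.tolledCost T e (G.load a e) * G.load a e := by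
  unfold userCost
  rw [G.sum_sum_alloc a fun _ e => (G.ℓ e).at (G.load a e) + (T (G.ℓ e)).at (G.load a e)]
  refine Finset.sum_congr rfl fun e _ => ?_
  rw [Finset.sum_const, nsmul_eq_mul, mul_comm]
  rfl

lemma userCost_update (T : LocalMechanism n) (a : G.Alloc) (i : Fin G.N)
    (s : {s : Finset G.E // s ∈ G.A i}) :
    G.userCost T i (Function.update a i s) = ∑ e ∈ s.1,
      if e ∈ (a i).1 then G.tolledCost T e (G.load a e) else G.tolledCost T e (G.load a e + 1) := by
  unfold userCost
  rw [Function.update_self]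
  refine Finset.sum_congr rfl fun e he => ?_
  rw [G.load_update a i s he, ← apply_ite (G.tolledCost T e)]
  rfl

/-- A deviating user who already used `e` leaves its load unchanged; a newcomer raises it by one. -/
lemma sum_userCost_update (T : LocalMechanism n) (a a' : G.Alloc) :
    ∑ i, G.userCost T i (Function.update a i (a' i)) =
      ∑ e, (G.tolledCost T e (G.load a e) * G.overlap a a' e +
        G.tolledCost T e (G.load a e + 1) * ((G.load a' e : ℝ) - G.overlap a a' e)) := by
  simp only [G.userCost_update]
  rw [G.sum_sum_alloc a' fun i e => if e ∈ (a i).1 then G.tolledCost T e (G.load a e)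
    else G.tolledCost T e (G.load a e + 1)]
  refine Finset.sum_congr rfl fun e _ => ?_
  rw [Finset.sum_ite, Finset.sum_const, Finset.sum_const, nsmul_eq_mul, nsmul_eq_mul]
  have h1 : ((Finset.univ.filter fun i => e ∈ (a' i).1).filter fun i => e ∈ (a i).1).card =
      G.overlap a a' e := by
    rw [Finset.filter_filter]
    simp only [overlap, and_comm]
  have h2 := Finset.card_filter_add_card_filter_not (s := Finset.univ.filter fun i => e ∈ (a' i).1)
    (fun i => e ∈ (a i).1)
  rw [h1] at h2
  have h3 : (((Finset.univ.filter fun i => e ∈ (a' i).1).filter fun i => e ∉ (a i).1).card : ℝ) =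
      (G.load a' e : ℝ) - G.overlap a a' e := by
    rw [eq_sub_iff_add_eq', ← Nat.cast_add, h2]
    rfl
  rw [h1, h3]
  ring

end CongestionGame

/-- The resource-wise smoothness inequality of an induced mechanism. -/
lemma IsInducedMechanism.overlap {n m : ℕ} (hn : 1 ≤ n) {b f : Fin m → CostFn n}
    {T : LocalMechanism n} (hT : IsInducedMechanism b f T) (hb : ∀ j, (b j).IsAdmissible)
    {ρ : Fin m → ℝ} {r : ℝ} (hf : ∀ j, SimplifiedLPFeasible (b j) (f j) (ρ j)) (h0 : 0 ≤ r)
    (hr : ∀ j, r ≤ ρ j) {ℓ : CostFn n} (hℓ : ℓ ∈ costClass b) {u v x : ℕ} (hxu : x ≤ u)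
    (hxv : x ≤ v) (hu : u ≤ n) (hv : v ≤ n) (hx : u + v ≤ n + x) :
    0 ≤ ℓ.total v - r * ℓ.total u + (ℓ.at u + (T ℓ).at u) * ((u : ℝ) - x) -
      (ℓ.at (u + 1) + (T ℓ).at (u + 1)) * ((v : ℝ) - x) := by
  obtain ⟨α, hα, hℓ', hTℓ⟩ := hT ℓ hℓ
  have hat : ∀ y, ℓ.at y = ∑ j, α j * (b j).at y := fun y => by
    rw [hℓ', CostFn.at_sum]; simp only [CostFn.at_smul]
  -- The toll must be expanded with the same `α` as the cost, so that the `b j` cancel and only the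
  -- `f j` remain.
  have hF : ∀ y, ℓ.at y + (T ℓ).at y = ∑ j, α j * (f j).at y := fun y => by
    rw [← CostFn.at_add, hTℓ]
    nth_rw 1 [hℓ']
    rw [← Finset.sum_add_distrib, CostFn.at_sum]
    refine Finset.sum_congr rfl fun j _ => ?_
    rw [← smul_add, add_sub_cancel, CostFn.at_smul]
  have htot : ∀ y, ℓ.total y = ∑ j, α j * (b j).total y := fun y => by
    simp only [CostFn.total, hat, Finset.sum_mul, mul_assoc]
  rw [htot, htot, hF, hF, Finset.mul_sum, Finset.sum_mul, Finset.sum_mul,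
    ← Finset.sum_sub_distrib, ← Finset.sum_add_distrib, ← Finset.sum_sub_distrib]
  refine Finset.sum_nonneg fun j _ => ?_
  have h1 := (hf j).overlap hn (hb j) (h0.trans (hr j)) hxu hxv hu hv hx
  have h2 := mul_le_mul_of_nonneg_right (hr j) (CostFn.total_nonneg (hb j).1 u)
  have h3 : 0 ≤ (b j).total v - r * (b j).total u + (f j).at u * ((u : ℝ) - x) -
      (f j).at (u + 1) * ((v : ℝ) - x) := by linarith
  have h4 := mul_nonneg (hα j) h3
  linarith

lemma IsInducedMechanism.smooth {n m : ℕ} (hn : 1 ≤ n) {b f : Fin m → CostFn n}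
    {T : LocalMechanism n} (hT : IsInducedMechanism b f T) (hb : ∀ j, (b j).IsAdmissible)
    {ρ : Fin m → ℝ} {r : ℝ} (hf : ∀ j, SimplifiedLPFeasible (b j) (f j) (ρ j)) (h0 : 0 ≤ r)
    (hr : ∀ j, r ≤ ρ j) (G : CongestionGame n) (hG : ∀ e, G.ℓ e ∈ costClass b)
    (a a' : G.Alloc) :
    r * G.systemCost a ≤ G.systemCost a' +
      ∑ i, (G.userCost T i a - G.userCost T i (Function.update a i (a' i))) := by
  rw [Finset.sum_sub_distrib, G.sum_userCost, G.sum_userCost_update, G.systemCost_eq,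
    G.systemCost_eq, Finset.mul_sum, ← Finset.sum_sub_distrib, ← Finset.sum_add_distrib]
  refine Finset.sum_le_sum fun e _ => ?_
  have := hT.overlap hn hb hf h0 hr (hG e) (G.overlap_le_left a a' e) (G.overlap_le_right a a' e)
    (G.load_le a e) (G.load_le a' e) (G.load_add_load_le a a' e)
  unfold CongestionGame.tolledCost
  linarith

/-! ### Equilibrium notions -/

namespace CongestionGame

variable {n : ℕ} (G : CongestionGame n)

lemma expect_mono {σ X Y : G.Alloc → ℝ} (hσ : σ ∈ stdSimplex ℝ G.Alloc) (h : ∀ a, X a ≤ Y a) :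
    G.expect σ X ≤ G.expect σ Y :=
  Finset.sum_le_sum fun a _ => mul_le_mul_of_nonneg_left (h a) (hσ.1 a)

lemma expect_single (a : G.Alloc) (X : G.Alloc → ℝ) : G.expect (Pi.single a 1) X = X a := by
  unfold expect
  rw [Finset.sum_eq_single a]
  · simp
  · intro c _ hc; simp [hc]
  · simp

lemma prod_mem_stdSimplex (p : ∀ i : Fin G.N, {s : Finset G.E // s ∈ G.A i} → ℝ)
    (hp : ∀ i, p i ∈ stdSimplex ℝ {s : Finset G.E // s ∈ G.A i}) :
    (fun a : G.Alloc => ∏ i, p i (a i)) ∈ stdSimplex ℝ G.Alloc := by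
  refine ⟨fun a => Finset.prod_nonneg fun i _ => (hp i).1 _, ?_⟩
  rw [← Fintype.piFinset_univ, ← Finset.prod_univ_sum]
  exact Finset.prod_eq_one fun i _ => (hp i).2

variable {G}

/-- Upper bounds therefore need only coarse correlated equilibria; by the converse inclusion for
point masses, lower bounds need only pure ones. -/
lemma IsEquilibrium.isCoarseCorrelated {T : LocalMechanism n} {σ : G.Alloc → ℝ} {κ : EqConcept}
    (h : G.IsEquilibrium T σ κ) : G.IsCoarseCorrelated T σ := by
  cases κ with
  | pureNash =>
    obtain ⟨a, ha, rfl⟩ := h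
    refine ⟨single_mem_stdSimplex ℝ a, fun i s => ?_⟩
    rw [G.expect_single, G.expect_single]
    exact ha i s
  | mixedNash =>
    obtain ⟨p, hp, hσ, h⟩ := h
    obtain rfl : σ = fun a => ∏ i, p i (a i) := funext hσ
    exact ⟨G.prod_mem_stdSimplex p hp, h⟩
  | correlated => exact ⟨h.1, fun i s => h.2 i fun _ => s⟩
  | coarseCorrelated => exact h

lemma IsPureNash.isEquilibrium_single {T : LocalMechanism n} {a : G.Alloc}
    (h : G.IsPureNash T a) (κ : EqConcept) : G.IsEquilibrium T (Pi.single a 1) κ := by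
  cases κ with
  | pureNash => exact ⟨a, h, rfl⟩
  | mixedNash =>
    refine ⟨fun i => Pi.single (a i) 1, fun i => single_mem_stdSimplex ℝ (a i), fun c => ?_,
      fun i s => ?_⟩
    · rcases eq_or_ne c a with rfl | hc
      · simp
      · obtain ⟨i, hi⟩ := Function.ne_iff.1 hc
        rw [Pi.single_eq_of_ne hc]
        exact (Finset.prod_eq_zero (Finset.mem_univ i) (Pi.single_eq_of_ne hi _)).symm
    · rw [G.expect_single, G.expect_single]
      exact h i s
  | correlated =>
    refine ⟨single_mem_stdSimplex ℝ a, fun i φ => ?_⟩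
    rw [G.expect_single, G.expect_single]
    exact h i (φ (a i))
  | coarseCorrelated =>
    refine ⟨single_mem_stdSimplex ℝ a, fun i s => ?_⟩
    rw [G.expect_single, G.expect_single]
    exact h i s

end CongestionGame

/-- The smoothness inequality compares with a fixed `a'`, so averaging it over `σ` leaves the
equilibrium conditions for deviations to `a' i`. -/
theorem IsInducedMechanism.PoA_le {n m : ℕ} (hn : 1 ≤ n) {b f : Fin m → CostFn n}
    {T : LocalMechanism n} (hT : IsInducedMechanism b f T) (hb : ∀ j, (b j).IsAdmissible)
    {ρ : Fin m → ℝ} {r : ℝ} (hf : ∀ j, SimplifiedLPFeasible (b j) (f j) (ρ j)) (h0 : 0 < r)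
    (hr : ∀ j, r ≤ ρ j) (κ : EqConcept) : PoA κ (costClass b) T ≤ ENNReal.ofReal (1 / r) := by
  refine iSup_le fun G => iSup_le fun hG => iSup_le fun σ => iSup_le fun hσ => ?_
  have hσ' := hσ.isCoarseCorrelated
  refine ENNReal.div_le_of_le_mul ?_
  rw [← ENNReal.ofReal_mul (by positivity)]
  refine ENNReal.ofReal_le_ofReal ?_
  rw [one_div, ← div_eq_inv_mul, le_div_iff₀' h0]
  refine le_ciInf fun a' => ?_
  have h1 := G.expect_mono hσ'.1 fun a => hT.smooth hn hb hf h0.le hr G hG a a'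
  have h2 : G.expect σ (fun a => r * G.systemCost a) = r * G.expect σ G.systemCost := by
    simp only [CongestionGame.expect, Finset.mul_sum]
    exact Finset.sum_congr rfl fun _ _ => by ring
  have h3 : G.expect σ (fun a => G.systemCost a' +
      ∑ i, (G.userCost T i a - G.userCost T i (Function.update a i (a' i)))) =
      G.systemCost a' + ∑ i, (G.expect σ (G.userCost T i) -
        G.expect σ fun a => G.userCost T i (Function.update a i (a' i))) := by
    simp only [CongestionGame.expect, mul_add, Finset.sum_add_distrib, ← Finset.sum_mul, hσ'.1.2,
      one_mul, Finset.mul_sum, ← Finset.sum_sub_distrib, mul_sub]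
    rw [Finset.sum_comm]
  have h4 : ∑ i, (G.expect σ (G.userCost T i) -
      G.expect σ fun a => G.userCost T i (Function.update a i (a' i))) ≤ 0 :=
    Finset.sum_nonpos fun i _ => sub_nonpos.2 (hσ'.2 i (a' i))
  linarith

lemma exists_isInducedMechanism {n m : ℕ} (b f : Fin m → CostFn n) :
    ∃ T : LocalMechanism n, IsInducedMechanism b f T := by
  classical
  refine ⟨fun ℓ => if h : ℓ ∈ costClass b then ∑ j, h.choose j • (f j - b j) else 0,
    fun ℓ hℓ => ⟨hℓ.choose, hℓ.choose_spec.1, hℓ.choose_spec.2, dif_pos hℓ⟩⟩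

/-! ### Cyclic games -/

section Cyclic

lemma card_fin_Ico (n a c : ℕ) (hc : c ≤ n) :
    (Finset.univ.filter fun s : Fin n => a ≤ s.val ∧ s.val < c).card = c - a := by
  have h : (Finset.univ.filter fun s : Fin n => a ≤ s.val ∧ s.val < c).map Fin.valEmbedding =
      Finset.Ico a c := by
    ext x
    simp only [Finset.mem_map, Finset.mem_filter, Finset.mem_univ, true_and, Finset.mem_Ico,
      Fin.valEmbedding_apply]
    exact ⟨fun ⟨s, hs, hx⟩ => hx ▸ hs, fun hx => ⟨⟨x, by omega⟩, hx, rfl⟩⟩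
  rw [← Finset.card_map, h, Nat.card_Ico]

variable {n : ℕ} {ι : Type} [Fintype ι]

/-- User `i` selects those resources `(k, r)` for which the offset `i - r` lies in the interval
`[lo k, hi k)`. -/
def offsetBlock (lo hi : ι → ℕ) (i : Fin n) : Finset (ι × Fin n) :=
  Finset.univ.filter fun e => lo e.1 ≤ (i - e.2).val ∧ (i - e.2).val < hi e.1

lemma mem_offsetBlock {lo hi : ι → ℕ} {i : Fin n} {e : ι × Fin n} :
    e ∈ offsetBlock lo hi i ↔ lo e.1 ≤ (i - e.2).val ∧ (i - e.2).val < hi e.1 := by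
  simp [offsetBlock]

lemma sum_prod_fin_fst (h : ι → ℝ) : ∑ e : ι × Fin n, h e.1 = n * ∑ k, h k := by
  rw [Fintype.sum_prod_type, Finset.mul_sum]
  exact Finset.sum_congr rfl fun k _ => by simp

variable [NeZero n]

/-- For fixed `i` the map `r ↦ i - r` permutes `ℤ/n`, so each user meets every block in the same
number of resources. -/
lemma sum_offsetBlock {lo hi : ι → ℕ} (hhi : ∀ k, hi k ≤ n) (i : Fin n) (h : ι → ℝ) :
    ∑ e ∈ offsetBlock lo hi i, h e.1 = ∑ k, h k * (hi k - lo k : ℕ) := by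
  unfold offsetBlock
  rw [Finset.sum_filter, Fintype.sum_prod_type]
  refine Finset.sum_congr rfl fun k _ => ?_
  simp only
  rw [← Finset.sum_filter, Finset.sum_const, nsmul_eq_mul, mul_comm,
    ← card_fin_Ico n _ _ (hhi k)]
  congr 2
  refine Finset.card_equiv (Equiv.subLeft i) fun r => ?_
  simp

variable [DecidableEq ι]

lemma card_users_offsetBlock {lo hi : ι → ℕ} (hhi : ∀ k, hi k ≤ n) (e : ι × Fin n) :
    (Finset.univ.filter fun i : Fin n => e ∈ offsetBlock lo hi i).card = hi e.1 - lo e.1 := by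
  rw [← card_fin_Ico n _ _ (hhi e.1)]
  refine Finset.card_equiv (Equiv.subRight e.2) fun i => ?_
  simp [mem_offsetBlock]

/-- The game with resources `ι × ℤ/n`, all with cost function `b`, in which each of the `n` users
chooses between the first `u k` and the last `v k` offsets of each block `k`. -/
def cyclicGame (b : CostFn n) (u v : ι → ℕ) : CongestionGame n where
  N := n
  N_le := le_rfl
  E := ι × Fin n
  ℓ _ := b
  A i := {offsetBlock (fun _ => 0) u i, offsetBlock (fun k => n - v k) (fun _ => n) i}
  A_nonempty _ := Finset.insert_nonempty _ _

namespace cyclicGame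

variable (b : CostFn n) (u v : ι → ℕ)

/-- All users choose the first offsets. -/
def first : (cyclicGame b u v).Alloc := fun _ => ⟨_, Finset.mem_insert_self _ _⟩

/-- All users choose the last offsets. -/
def last : (cyclicGame b u v).Alloc := fun _ =>
  ⟨_, Finset.mem_insert_of_mem (Finset.mem_singleton_self _)⟩

variable {u v}

lemma load_first (hu : ∀ k, u k ≤ n) (e : ι × Fin n) :
    (cyclicGame b u v).load (first b u v) e = u e.1 :=
  (card_users_offsetBlock hu e).trans (Nat.sub_zero _)

lemma load_last (hv : ∀ k, v k ≤ n) (e : ι × Fin n) :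
    (cyclicGame b u v).load (last b u v) e = v e.1 :=
  (card_users_offsetBlock (fun _ => le_rfl) e).trans (Nat.sub_sub_self (hv e.1))

lemma systemCost_first (hu : ∀ k, u k ≤ n) :
    (cyclicGame b u v).systemCost (first b u v) = n * ∑ k, b.total (u k) := by
  rw [CongestionGame.systemCost_eq, ← sum_prod_fin_fst]
  exact Finset.sum_congr rfl fun e _ => congrArg b.total (load_first b hu e)

lemma systemCost_last (hv : ∀ k, v k ≤ n) :
    (cyclicGame b u v).systemCost (last b u v) = n * ∑ k, b.total (v k) := by
  rw [CongestionGame.systemCost_eq, ← sum_prod_fin_fst]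
  exact Finset.sum_congr rfl fun e _ => congrArg b.total (load_last b hv e)

lemma userCost_first (T : LocalMechanism n) (hu : ∀ k, u k ≤ n) (i : Fin n) :
    (cyclicGame b u v).userCost T i (first b u v) =
      ∑ k, (b.at (u k) + (T b).at (u k)) * u k := by
  refine Eq.trans ?_ (sum_offsetBlock (lo := fun _ => 0) hu i
    fun k => b.at (u k) + (T b).at (u k))
  exact Finset.sum_congr rfl fun e _ =>
    congrArg (fun x => b.at x + (T b).at x) (load_first b hu e)

lemma userCost_deviation (T : LocalMechanism n) (hu : ∀ k, u k ≤ n) (hv : ∀ k, v k ≤ n)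
    (i : Fin n) :
    (cyclicGame b u v).userCost T i (Function.update (first b u v) i (last b u v i)) =
      ∑ k, ((b.at (u k) + (T b).at (u k)) * (u k + v k - n : ℕ) +
        (b.at (u k + 1) + (T b).at (u k + 1)) * ((v k : ℝ) - (u k + v k - n : ℕ))) := by
  have hsplit : ∀ h h' : ι → ℝ,
      ∑ e ∈ offsetBlock (fun k => n - v k) (fun _ => n) i,
        (if e ∈ offsetBlock (fun _ => 0) u i then h e.1 else h' e.1) =
      ∑ k, (h k * (u k + v k - n : ℕ) + h' k * ((v k : ℝ) - (u k + v k - n : ℕ))) := by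
    intro h h'
    have h1 : ∀ e : ι × Fin n, (if e ∈ offsetBlock (fun _ => 0) u i then h e.1 else h' e.1) =
        h' e.1 + if e ∈ offsetBlock (fun _ => 0) u i then h e.1 - h' e.1 else 0 := by
      intro e; split_ifs <;> ring
    -- The offset intervals `[0, u k)` and `[n - v k, n)` meet in `[n - v k, u k)`, which has the
    -- smallest possible length.
    have h2 : (offsetBlock (fun k => n - v k) (fun _ => n) i).filter
        (fun e => e ∈ offsetBlock (fun _ => 0) u i) = offsetBlock (fun k => n - v k) u i := by
      ext e
      simp only [Finset.mem_filter, mem_offsetBlock, Nat.zero_le, true_and]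
      exact ⟨fun h => ⟨h.1.1, h.2⟩, fun h => ⟨⟨h.1, (i - e.2).isLt⟩, h.2⟩⟩
    rw [Finset.sum_congr rfl fun e _ => h1 e, Finset.sum_add_distrib, ← Finset.sum_filter, h2,
      sum_offsetBlock (fun _ => le_rfl), sum_offsetBlock hu i fun k => h k - h' k,
      ← Finset.sum_add_distrib]
    refine Finset.sum_congr rfl fun k _ => ?_
    rw [Nat.sub_sub_self (hv k), show u k - (n - v k) = u k + v k - n by have := hv k; omega]
    ring
  refine ((cyclicGame b u v).userCost_update T _ i _).trans (Eq.trans (Finset.sum_congr rfl fun e _ => ?_)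
    (hsplit (fun k => b.at (u k) + (T b).at (u k))
      (fun k => b.at (u k + 1) + (T b).at (u k + 1))))
  rw [load_first b hu e]
  rfl

/-- Choosing the first offsets is a Nash equilibrium if deviating does not pay off on average
over the blocks. -/
lemma isPureNash_first (T : LocalMechanism n) (hu : ∀ k, u k ≤ n) (hv : ∀ k, v k ≤ n)
    (h : ∑ k, ((b.at (u k) + (T b).at (u k)) * ((u k : ℝ) - (u k + v k - n : ℕ)) -
      (b.at (u k + 1) + (T b).at (u k + 1)) * ((v k : ℝ) - (u k + v k - n : ℕ))) ≤ 0) :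
    (cyclicGame b u v).IsPureNash T (first b u v) := by
  rintro i ⟨s, hs⟩
  have hs' := hs
  rcases Finset.mem_insert.1 hs' with rfl | hs'
  · exact (congrArg _ (Function.update_eq_self i (first b u v)).symm).le
  · obtain rfl := Finset.mem_singleton.1 hs'
    refine (userCost_first b T hu i).le.trans (le_trans ?_ (userCost_deviation b T hu hv i).ge)
    rw [← sub_nonpos, ← Finset.sum_sub_distrib]
    refine le_trans (Finset.sum_le_sum fun k _ => ?_) h
    linarith

end cyclicGame

/-- A bound on the price of anarchy bounds the cost of the equilibrium of the cyclic game. -/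
lemma sum_total_le_of_PoA_le {b : CostFn n} {L : Set (CostFn n)} (hbL : b ∈ L)
    {T : LocalMechanism n} {κ : EqConcept} {R : ℝ} (hR : 0 ≤ R)
    (hPoA : PoA κ L T ≤ ENNReal.ofReal R) (hb : ∀ x, 0 < b x) {u v : ι → ℕ}
    (hu : ∀ k, u k ≤ n) (hv : ∀ k, v k ≤ n)
    (h : ∑ k, ((b.at (u k) + (T b).at (u k)) * ((u k : ℝ) - (u k + v k - n : ℕ)) -
      (b.at (u k + 1) + (T b).at (u k + 1)) * ((v k : ℝ) - (u k + v k - n : ℕ))) ≤ 0) :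
    ∑ k, b.total (u k) ≤ R * ∑ k, b.total (v k) := by
  let G := cyclicGame b u v
  have hnash := cyclicGame.isPureNash_first b T hu hv h
  have h1 : ENNReal.ofReal (G.expect (Pi.single (cyclicGame.first b u v) 1) G.systemCost) /
      ENNReal.ofReal G.minCost ≤ ENNReal.ofReal R :=
    (le_iSup₂_of_le (f := fun (σ : G.Alloc → ℝ) (_ : G.IsEquilibrium T σ κ) =>
      ENNReal.ofReal (G.expect σ G.systemCost) / ENNReal.ofReal G.minCost) _
      (hnash.isEquilibrium_single κ) le_rfl).trans
      ((le_iSup₂_of_le (f := fun (G : CongestionGame n) (_ : ∀ e, G.ℓ e ∈ L) =>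
        ⨆ (σ : G.Alloc → ℝ) (_ : G.IsEquilibrium T σ κ),
          ENNReal.ofReal (G.expect σ G.systemCost) / ENNReal.ofReal G.minCost)
        G (fun _ => hbL) le_rfl).trans hPoA)
  rw [G.expect_single, ENNReal.div_le_iff_le_mul (.inr ENNReal.ofReal_ne_top)
    (.inl ENNReal.ofReal_ne_top), ← ENNReal.ofReal_mul hR] at h1
  have hnonneg : ∀ a, 0 ≤ G.systemCost a := fun a => by
    rw [G.systemCost_eq]
    exact Finset.sum_nonneg fun e _ => CostFn.total_nonneg hb _
  have hmin : 0 ≤ G.minCost := le_ciInf hnonneg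
  rw [ENNReal.ofReal_le_ofReal_iff (mul_nonneg hR hmin)] at h1
  have h2 : G.minCost ≤ G.systemCost (cyclicGame.last b u v) :=
    ciInf_le ⟨0, by rintro _ ⟨a, rfl⟩; exact hnonneg a⟩ _
  have h3 := h1.trans (mul_le_mul_of_nonneg_left h2 hR)
  rw [cyclicGame.systemCost_first b hu, cyclicGame.systemCost_last b hv] at h3
  have hn : (0 : ℝ) < n := by exact_mod_cast NeZero.pos n
  refine le_of_mul_le_mul_left ?_ hn
  linarith

end Cyclic

/-! ### Scaling tolled costs to a feasible solution -/

/-- A one-dimensional Farkas lemma for natural number weights. -/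
lemma exists_multiplier {α : Type*} (S : Finset α) (hS : S.Nonempty) (A c : α → ℝ)
    (h : ∀ p ∈ S, ∀ q ∈ S, ∀ s t : ℕ, s * A p + t * A q ≤ 0 → 0 ≤ s * c p + t * c q) :
    ∃ l : ℝ, ∀ p ∈ S, 0 ≤ c p + l * A p := by
  -- The least nonnegative multiplier that settles all indices with `A > 0`; if it is positive, the
  -- constraint at the maximizer `p` is tight.
  obtain ⟨p, hp, hmax⟩ := S.exists_max_image
    (fun p => if 0 < A p then max 0 (-c p / A p) else 0) hS
  set l := if 0 < A p then max 0 (-c p / A p) else 0 with hl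
  have hl' : l = 0 ∨ 0 < A p ∧ 0 ≤ l ∧ c p = -(l * A p) := by
    rw [hl]
    split_ifs with hA
    · rcases le_total (-c p / A p) 0 with h0 | h0
      · exact .inl (max_eq_left h0)
      · refine .inr ⟨hA, le_max_left _ _, ?_⟩
        rw [max_eq_right h0]
        field_simp
    · exact .inl rfl
  refine ⟨l, fun q hq => ?_⟩
  rcases le_or_gt (A q) 0 with hA | hA
  · rcases hl' with h0 | ⟨hAp, hl0, hcp⟩
    · have := h q hq q hq 0 1 (by simpa using hA)
      rw [h0]
      simpa using this
    · by_contra! hneg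
      -- The weights that balance `A p` against `A q` need not have a rational ratio. Rounding the
      -- weight of `p` down costs at most `l * A p`, which `t` copies of the deficit at `q` exceed.
      obtain ⟨t, ht⟩ := exists_nat_gt (l * A p / -(c q + l * A q))
      rw [div_lt_iff₀ (by linarith)] at ht
      have hx : 0 ≤ t * (-A q) / A p :=
        div_nonneg (mul_nonneg (by positivity) (by linarith)) hAp.le
      have h1 := Nat.floor_le hx
      have h2 := Nat.lt_floor_add_one (t * (-A q) / A p)
      rw [le_div_iff₀ hAp] at h1
      rw [div_lt_iff₀ hAp] at h2
      have h3 := h p hp q hq _ t (by linarith)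
      have h4 := mul_le_mul_of_nonneg_left h2.le hl0
      rw [hcp] at h3
      linarith
  · have h1 := hmax q hq
    rw [if_pos hA] at h1
    have h2 := (le_max_right _ _).trans h1
    rw [div_le_iff₀ hA] at h2
    linarith

/-- If a mechanism has price of anarchy at most `R`, then a multiple of the tolled cost is
feasible for the simplified program with `ρ = 1 / R`. -/
lemma exists_feasible_of_PoA_le {n : ℕ} (hn : 1 ≤ n) {b : CostFn n} {L : Set (CostFn n)}
    (hbL : b ∈ L) {T : LocalMechanism n} {κ : EqConcept} {R : ℝ} (hR : 0 < R)
    (hPoA : PoA κ L T ≤ ENNReal.ofReal R) (hb : ∀ x, 0 < b x) :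
    ∃ f, SimplifiedLPFeasible b f (1 / R) := by
  have : NeZero n := ⟨by omega⟩
  let S := Finset.range (n + 1) ×ˢ Finset.range (n + 1)
  let A : ℕ × ℕ → ℝ := fun p =>
    (b.at p.1 + (T b).at p.1) * ((p.1 : ℝ) - (p.1 + p.2 - n : ℕ)) -
      (b.at (p.1 + 1) + (T b).at (p.1 + 1)) * ((p.2 : ℝ) - (p.1 + p.2 - n : ℕ))
  let c : ℕ × ℕ → ℝ := fun p => b.total p.2 - 1 / R * b.total p.1
  have hle : ∀ p ∈ S, p.1 ≤ n ∧ p.2 ≤ n := by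
    intro p hp
    have := Finset.mem_product.1 hp
    simp only [Finset.mem_range] at this
    omega
  obtain ⟨l, hl⟩ := exists_multiplier S ⟨(0, 0), by simp [S]⟩ A c (by
    intro p hp q hq s t hst
    -- A cyclic game with `s` blocks of type `p` and `t` blocks of type `q`.
    let w : Fin s ⊕ Fin t → ℕ × ℕ := Sum.elim (fun _ => p) (fun _ => q)
    have hw : ∀ k, (w k).1 ≤ n ∧ (w k).2 ≤ n := by
      rintro (k | k)
      · exact hle p hp
      · exact hle q hq
    have hsum : ∀ X : ℕ × ℕ → ℝ, ∑ k, X (w k) = s * X p + t * X q := by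
      intro X; simp [w]
    have h1 := sum_total_le_of_PoA_le hbL hR.le hPoA hb (u := fun k => (w k).1)
      (v := fun k => (w k).2) (fun k => (hw k).1) (fun k => (hw k).2) ((hsum A).trans_le hst)
    rw [hsum fun p => b.total p.1, hsum fun p => b.total p.2, ← div_le_iff₀' hR] at h1
    have h2 : s * c p + t * c q = (s * b.total p.2 + t * b.total q.2) -
        (s * b.total p.1 + t * b.total q.1) / R := by
      simp only [c]; ring
    rw [h2]
    linarith)
  refine ⟨l • (b + T b), simplifiedLPFeasible_iff.2 fun u v hu hv => ?_⟩
  have := hl (u, v) (by simp only [S, Finset.mem_product, Finset.mem_range]; omega)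
  simp only [A, c] at this
  simp only [CostFn.at_smul, CostFn.at_add]
  linarith

/-- No local mechanism has a smaller price of anarchy than the reciprocal of the value of the
simplified program. -/
theorem IsSimplifiedLPSolution.ofReal_le_PoA {n : ℕ} (hn : 1 ≤ n) {b f : CostFn n} {ρ : ℝ}
    (hb : b.IsAdmissible) (h : IsSimplifiedLPSolution b f ρ) {L : Set (CostFn n)} (hbL : b ∈ L)
    (T : LocalMechanism n) (κ : EqConcept) : ENNReal.ofReal (1 / ρ) ≤ PoA κ L T := by
  have hρ := h.pos hn hb
  by_contra! hlt
  -- A bound `R < 1 / ρ` on the price of anarchy would make `1 / R > ρ` feasible.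
  obtain ⟨R, hPR, hRρ⟩ := ENNReal.lt_iff_exists_nnreal_btwn.1 hlt
  have hR : 0 < (R : ℝ) := by
    have : (0 : ENNReal) < R := (zero_le).trans_lt hPR
    exact_mod_cast this
  have hR' : (R : ℝ) < 1 / ρ := by
    rw [← ENNReal.ofReal_coe_nnreal] at hRρ
    exact (ENNReal.ofReal_lt_ofReal_iff (by positivity)).1 hRρ
  obtain ⟨f', hf'⟩ := exists_feasible_of_PoA_le hn hbL hR
    (hPR.le.trans ENNReal.ofReal_coe_nnreal.ge) hb.1
  have := h.2 _ _ hf'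
  rw [lt_div_iff₀ hρ] at hR'
  rw [div_le_iff₀ hR] at this
  linarith

/-! ### The main theorem. -/

lemma mem_costClass {n m : ℕ} (b : Fin m → CostFn n) (j : Fin m) : b j ∈ costClass b := by
  refine ⟨Pi.single j 1, fun k => ?_, ?_⟩
  · rcases eq_or_ne k j with rfl | hk
    · simp
    · simp [hk]
  · rw [Finset.sum_eq_single j]
    · simp
    · intro k _ hk; simp [hk]
    · simp

theorem theorem2 (n m : ℕ) (hn : 1 ≤ n) (hm : 1 ≤ m) (b : Fin m → CostFn n)
    (hb : ∀ j, (b j).IsAdmissible) :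
    -- (i) each simplified program is solvable, and any solutions yield an optimal mechanism
    ((∀ j, ∃ f ρ, IsSimplifiedLPSolution (b j) f ρ) ∧
      ∀ (f : Fin m → CostFn n) (ρ : Fin m → ℝ),
        (∀ j, IsSimplifiedLPSolution (b j) (f j) (ρ j)) →
          (∀ j, 0 < ρ j) ∧
          (∃ T : LocalMechanism n, IsInducedMechanism b f T) ∧
          ∀ T : LocalMechanism n, IsInducedMechanism b f T →
            ∀ κ : EqConcept,
              (∀ T' : LocalMechanism n, PoA κ (costClass b) T ≤ PoA κ (costClass b) T') ∧
              PoA κ (costClass b) T = ⨆ j, ENNReal.ofReal (1 / ρ j)) ∧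
    -- (ii) the explicit expressions solve the simplified programs
    (∀ j, ∃ (ρ : ℝ) (f : CostFn n),
      IsLeast (tupleRatio (b j) '' tuples n) ρ ∧
      SatisfiesRecursion (b j) ρ f ∧
      IsSimplifiedLPSolution (b j) f ρ) := by
  refine ⟨⟨fun j => ?_, fun f ρ hf => ?_⟩, fun j => exists_explicit_solution hn (hb j)⟩
  · obtain ⟨ρ, f, -, -, h⟩ := exists_explicit_solution hn (hb j)
    exact ⟨f, ρ, h⟩
  · have hpos : ∀ j, 0 < ρ j := fun j => (hf j).pos hn (hb j)
    have hlower : ∀ (T : LocalMechanism n) (κ : EqConcept),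
        ⨆ j, ENNReal.ofReal (1 / ρ j) ≤ PoA κ (costClass b) T := fun T κ =>
      iSup_le fun j => (hf j).ofReal_le_PoA hn (hb j) (mem_costClass b j) T κ
    refine ⟨hpos, exists_isInducedMechanism b f, fun T hT κ => ?_⟩
    have : Nonempty (Fin m) := ⟨⟨0, hm⟩⟩
    -- The smallest `ρ j` serves as the common smoothness constant for all basis functions.
    obtain ⟨j, hj⟩ := Finite.exists_min ρ
    have hupper : PoA κ (costClass b) T ≤ ⨆ j, ENNReal.ofReal (1 / ρ j) :=
      (hT.PoA_le hn hb (fun j => (hf j).1) (hpos j) hj κ).trans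
        (le_iSup (fun j => ENNReal.ofReal (1 / ρ j)) j)
    exact ⟨fun T' => hupper.trans (hlower T' κ), hupper.antisymm (hlower T κ)⟩
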